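/- Let $L>0$, $0<n_-<n_+$ and $\rho>0$. Let $\mathcal A_{sym}$ be the set of measurable $n:\mathbb R\to\mathbb R$ with $n_-\le n\le n_+$ on $[0,L]$, $n=1$ off $[0,L]$ and $n(x)=n(L-x)$ (all up to null sets). A number $\omega\in\mathbb C$ is a scattering resonance of $n$, $\omega\in\mathrm{Res}_n$, if there is a nontrivial $u\in L^1_{\rm loc}(\mathbb R;\mathbb C)$ with $$u(x)=\omega^2\int_0^L G(|x-y|,\omega)\,[n^2(y)-1]\,u(y)\,dy\quad\text{for a.e. } x\in\mathbb R,\qquad G(r,\omega)=-\frac{1}{2i\omega}e^{i\omega r}$$ (the right-hand side being read as $0$ for $\omega=0$, so that $0\notin\mathrm{Res}_n$), and $\Gamma^\rho[n]:=\inf\{|\Im\omega| : \omega\in\mathrm{Res}_n,\ |\Re\omega|\le\rho\}$, with $\inf\emptyset=\infty$. Let $n_\star\in\mathcal A_{sym}$ be a local minimizer, with respect to the $L^\infty$ distance, of $\Gamma^\rho$ over $\mathcal A_{sym}$ (for instance a global minimizer), and suppose that $\Gamma^\rho[n_\star]=|\Im\omega_\star|$ for some $\omega_\star\in\mathrm{Res}_{n_\star}$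 with $0<|\Re\omega_\star|<\rho$. Then $n_\star$ has only finitely many transition points between $n_+$ and $n_-$, that is, points $x\in[0,L]$ every neighbourhood of which in $[0,L]$ contains both a subset of positive measure on which $n_\star=n_+$ and one on which $n_\star=n_-$. Moreover $n_\star$ is a step function: there are $0=x_0<x_1<\dots<x_N=L$ such that, for each $j$, either $n_\star=n_+$ a.e. on $(x_j,x_{j+1})$ or $n_\star=n_-$ a.e. on $(x_j,x_{j+1})$. -/

import Mathlib

open MeasureTheory

noncomputable section

namespace ScatRes

/-- The outgoing free-space Green's function of `-d²/dx² - ω²` on the line, as a function of the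
distance `r = |x - y|`: `G(r, ω) = -(2iω)⁻¹ exp(iωr)`. -/
def green (r : ℝ) (ω : ℂ) : ℂ :=
  -(2 * Complex.I * ω)⁻¹ * Complex.exp (Complex.I * ω * (r : ℂ))

/-- `(ω, u)` is a scattering resonance pair of the index `n` on `[0, L]`: `u` is a nontrivial
locally integrable solution of
`u(x) = ω² ∫_{[0,L]} G(|x - y|, ω) (n(y)² - 1) u(y) dy`.
For `ω = 0` the right-hand side is `0`, so `0` is never a resonance. -/
structure IsResonancePair (L : ℝ) (n : ℝ → ℝ) (ω : ℂ) (u : ℝ → ℂ) : Prop where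
  locallyIntegrable : LocallyIntegrable u volume
  nontrivial : ¬ (u =ᵐ[volume] 0)
  equation : ∀ᵐ x : ℝ, u x =
    ω ^ 2 * ∫ y in Set.Icc 0 L, green |x - y| ω * ((n y : ℂ) ^ 2 - 1) * u y

/-- The set of scattering resonances of the index `n`. -/
def Res (L : ℝ) (n : ℝ → ℝ) : Set ℂ :=
  {ω | ∃ u : ℝ → ℂ, IsResonancePair L n ω u}

/-- The scattering resonances `ω` of `n` with `|Re ω| ≤ ρ`. -/
def ResBelow (L ρ : ℝ) (n : ℝ → ℝ) : Set ℂ :=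
  {ω | ω ∈ Res L n ∧ |ω.re| ≤ ρ}

/-- The minimal resonance width `Γ^ρ[n] = inf {|Im ω| : ω ∈ Res_n, |Re ω| ≤ ρ}`,
equal to `∞` if there is no such resonance. -/
def width (L ρ : ℝ) (n : ℝ → ℝ) : ENNReal :=
  ⨅ ω ∈ ResBelow L ρ n, ENNReal.ofReal |ω.im|

/-- The admissible indices: measurable, `n = 1` off `[0, L]`, and `n₋ ≤ n ≤ n₊` on `[0, L]`
(as for elements of `L^∞`, up to null sets). -/
def Admissible (L nminus nplus : ℝ) : Set (ℝ → ℝ) :=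
  {n | AEMeasurable n volume ∧
    (∀ᵐ x : ℝ, x ∉ Set.Icc 0 L → n x = 1) ∧
    (∀ᵐ x : ℝ, x ∈ Set.Icc 0 L → nminus ≤ n x ∧ n x ≤ nplus)}

/-- The admissible indices that are symmetric about `L / 2`. -/
def AdmissibleSym (L nminus nplus : ℝ) : Set (ℝ → ℝ) :=
  {n | n ∈ Admissible L nminus nplus ∧ ∀ᵐ x : ℝ, n x = n (L - x)}

/-- `n` minimizes `Γ^ρ` among the symmetric admissible indices in some `L^∞`-ball around `n`.
In particular every global minimizer over the symmetric admissible indices is one. -/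
def IsLocallyOptimal (L nminus nplus ρ : ℝ) (n : ℝ → ℝ) : Prop :=
  n ∈ AdmissibleSym L nminus nplus ∧
  ∃ δ : ℝ, 0 < δ ∧ ∀ m ∈ AdmissibleSym L nminus nplus,
    eLpNorm (fun x => m x - n x) ⊤ volume < ENNReal.ofReal δ → width L ρ n ≤ width L ρ m

/-- `x ∈ [0, L]` is a transition point of `n` between `n₊` and `n₋`: in every neighbourhood of `x`
in `[0, L]`, both values are taken on sets of positive measure. -/
def IsTransitionPoint (L nminus nplus : ℝ) (n : ℝ → ℝ) (x : ℝ) : Prop :=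
  x ∈ Set.Icc 0 L ∧ ∀ ε : ℝ, 0 < ε →
    0 < volume {y : ℝ | y ∈ Set.Icc 0 L ∧ |y - x| < ε ∧ n y = nplus} ∧
    0 < volume {y : ℝ | y ∈ Set.Icc 0 L ∧ |y - x| < ε ∧ n y = nminus}

/-- `n` agrees almost everywhere on `[0, L]` with a step function with values `n₊` and `n₋`:
there is a finite partition `0 = x₀ < x₁ < ⋯ < x_N = L` such that on each `(x_j, x_{j+1})` either
`n = n₊` a.e. or `n = n₋` a.e. -/
def IsStepFunction (L nminus nplus : ℝ) (n : ℝ → ℝ) : Prop :=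
  ∃ (N : ℕ) (x : Fin (N + 1) → ℝ), StrictMono x ∧ x 0 = 0 ∧ x (Fin.last N) = L ∧
    ∀ j : Fin N,
      (∀ᵐ y : ℝ, y ∈ Set.Ioo (x j.castSucc) (x j.succ) → n y = nplus) ∨
      (∀ᵐ y : ℝ, y ∈ Set.Ioo (x j.castSucc) (x j.succ) → n y = nminus)

end ScatRes

end

noncomputable section

namespace ScatRes

open Set Filter Topology

/-! A nonzero `ω` is a resonance exactly when the solution of `u'' = -ω² n² u` on `[0, L]` with data
`(1, -iω)` at `0` is outgoing at `L`, that is, when `charFun` vanishes (`exists_isMode_of_mem_res`,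
`IsMode.mem_res`). Replace `n²` by `n² + tβ`. The characteristic function becomes a smooth `F(ω, t)`
with `∂ₜF = -ω² / u(L) · ∫ β u²` at the mode (`hasDerivAt_charFun`).

If `F(·, 0)` has leading term `B (z - ω)ᵏ` and `A` is this derivative, rescaled zeros near `ω`
approach the `k`-th roots of `-A/B`. When `Im (-A/B) > 0` one root lies in the upper half-plane, so
a zero moves towards the real axis (`exists_zero_im_lt`); simplicity of the resonance is not needed.
Local optimality therefore gives a single `C ≠ 0` with `∫ β Im (C u²) ≤ 0` for all symmetric
admissible `β` (`exists_multiplier`).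

By symmetry `u(L - x) = ±u(x)`, so `Im (C u²)` is symmetric. The direction that pushes `n` to an
extreme value according to the sign of this function is then admissible, and `n` must be extremal
off its zeros (`bangBang`).

It remains to see that the zeros are finite in number. The flux `Im (ū u')` has derivative `-Im(ω²)
n² |u|²` and vanishes at `L/2`, so it is nonzero on `(L/2, L]`: the curve `u` rotates in one
direction there and meets any line through the origin in isolated points. At `L/2` itself,
interlacing of the zeros of the real and imaginary parts excludes accumulation
(`finite_re_eq_zero`). Since `Im (C u²)` is a product of two such real parts, it has finitely many
zeros (`IsMode.finite_im_sq_eq_zero`). -/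

/-! ### Primitives of integrable functions on `[0, L]` -/

/-- `f` is a primitive on `[0, L]` of the integrable function `φ`. -/
structure IsPrim (L : ℝ) (f φ : ℝ → ℂ) : Prop where
  nonneg : 0 ≤ L
  integrable : IntervalIntegrable φ volume 0 L
  eq : ∀ x ∈ Icc 0 L, f x = f 0 + ∫ y in (0 : ℝ)..x, φ y

/-- The real and imaginary parts reduce this to real integrands; they are recombined as scalar
multiples of `1` and `I`. -/
theorem absolutelyContinuousOnInterval_integral {φ : ℝ → ℂ} {a b : ℝ}
    (h : IntervalIntegrable φ volume a b) :
    AbsolutelyContinuousOnInterval (fun x => ∫ y in a..x, φ y) a b := by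
  have hre : IntervalIntegrable (fun y => (φ y).re) volume a b :=
    ⟨h.1.re, h.2.re⟩
  have him : IntervalIntegrable (fun y => (φ y).im) volume a b :=
    ⟨h.1.im, h.2.im⟩
  have h1 := hre.absolutelyContinuousOnInterval_intervalIntegral (c := a) (by simp)
  have h2 := him.absolutelyContinuousOnInterval_intervalIntegral (c := a) (by simp)
  have hc (z : ℂ) : AbsolutelyContinuousOnInterval (fun _ : ℝ => z) a b :=
    (LipschitzWith.const z).lipschitzOnWith.absolutelyContinuousOnInterval (K := 0)
  have h3 := (h1.fun_smul (hc 1)).fun_add (h2.fun_smul (hc Complex.I))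
  unfold AbsolutelyContinuousOnInterval at h3 ⊢
  refine h3.congr' ?_
  rw [Filter.EventuallyEq, eventually_inf_principal]
  refine Eventually.of_forall fun E hE => Finset.sum_congr rfl fun i hi => ?_
  have key : ∀ x ∈ uIcc a b, (∫ y in a..x, (φ y).re) • (1 : ℂ) +
      (∫ y in a..x, (φ y).im) • Complex.I = ∫ y in a..x, φ y := by
    intro x hx
    have hx' : IntervalIntegrable φ volume a x :=
      h.mono_set (uIcc_subset_uIcc left_mem_uIcc hx)
    have e1 : (∫ y in a..x, (φ y).re) = (∫ y in a..x, φ y).re :=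
      intervalIntegral.intervalIntegral_re hx'
    have e2 : (∫ y in a..x, (φ y).im) = (∫ y in a..x, φ y).im :=
      intervalIntegral.intervalIntegral_im hx'
    rw [e1, e2]
    simp [Complex.re_add_im]
  have hm := hE.1 i hi
  simp only [key _ hm.1, key _ hm.2]

namespace IsPrim

variable {L : ℝ} {f g φ γ : ℝ → ℂ}

theorem intervalIntegrable (hf : IsPrim L f φ) {a b : ℝ} (ha : a ∈ Icc 0 L) (hb : b ∈ Icc 0 L) :
    IntervalIntegrable φ volume a b := by
  refine hf.integrable.mono_set ?_
  rw [uIcc_of_le (ha.1.trans ha.2)]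
  exact uIcc_subset_Icc ha hb

theorem sub_eq (hf : IsPrim L f φ) {a b : ℝ} (ha : a ∈ Icc 0 L) (hb : b ∈ Icc 0 L) :
    f b - f a = ∫ y in a..b, φ y := by
  have h0 : (0 : ℝ) ∈ Icc 0 L := ⟨le_rfl, ha.1.trans ha.2⟩
  rw [hf.eq b hb, hf.eq a ha, ← intervalIntegral.integral_add_adjacent_intervals
    (hf.intervalIntegrable h0 ha) (hf.intervalIntegrable ha hb)]
  ring

theorem continuousOn (hf : IsPrim L f φ) : ContinuousOn f (Icc 0 L) := by
  have := intervalIntegral.continuousOn_primitive_interval' hf.integrable left_mem_uIcc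
  rw [uIcc_of_le hf.nonneg] at this
  exact (continuousOn_const.add this).congr hf.eq

theorem congr_ae (hf : IsPrim L f φ) (h : ∀ᵐ x, x ∈ Icc 0 L → φ x = γ x) : IsPrim L f γ := by
  have h' : ∀ᵐ x, x ∈ uIoc 0 L → φ x = γ x := by
    filter_upwards [h] with x hx hx'
    rw [uIoc_of_le hf.nonneg] at hx'
    exact hx ⟨hx'.1.le, hx'.2⟩
  refine ⟨hf.nonneg, hf.integrable.congr_ae ((ae_restrict_iff' measurableSet_uIoc).2 h'),
    fun x hx => ?_⟩
  rw [hf.eq x hx]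
  congr 1
  refine intervalIntegral.integral_congr_ae ?_
  filter_upwards [h] with y hy hy'
  rw [uIoc_of_le hx.1] at hy'
  exact hy ⟨hy'.1.le, hy'.2.trans hx.2⟩

theorem congr (hf : IsPrim L f φ) (h : ∀ x ∈ Icc 0 L, φ x = γ x) : IsPrim L f γ :=
  hf.congr_ae (Eventually.of_forall h)

theorem add (hf : IsPrim L f φ) (hg : IsPrim L g γ) :
    IsPrim L (fun x => f x + g x) (fun x => φ x + γ x) := by
  refine ⟨hf.nonneg, hf.integrable.add hg.integrable, fun x hx => ?_⟩
  have h0 : (0 : ℝ) ∈ Icc 0 L := ⟨le_rfl, hx.1.trans hx.2⟩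
  rw [intervalIntegral.integral_add (hf.intervalIntegrable h0 hx) (hg.intervalIntegrable h0 hx),
    hf.eq x hx, hg.eq x hx]
  ring

theorem const_mul (c : ℂ) (hf : IsPrim L f φ) :
    IsPrim L (fun x => c * f x) (fun x => c * φ x) := by
  refine ⟨hf.nonneg, hf.integrable.const_mul c, fun x hx => ?_⟩
  rw [intervalIntegral.integral_const_mul, hf.eq x hx, mul_add]

theorem sub (hf : IsPrim L f φ) (hg : IsPrim L g γ) :
    IsPrim L (fun x => f x - g x) (fun x => φ x - γ x) := by
  simpa [sub_eq_add_neg] using hf.add (hg.const_mul (-1))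

theorem conj (hf : IsPrim L f φ) :
    IsPrim L (fun x => (starRingEnd ℂ) (f x)) (fun x => (starRingEnd ℂ) (φ x)) := by
  refine ⟨hf.nonneg, ?_, fun x hx => ?_⟩
  · exact ⟨Complex.conjCLE.toContinuousLinearMap.integrable_comp hf.integrable.1,
      Complex.conjCLE.toContinuousLinearMap.integrable_comp hf.integrable.2⟩
  · rw [hf.eq x hx, map_add]
    congr 1
    simp only [intervalIntegral, map_sub, integral_conj]

theorem ae_hasDerivAt (hφ : IntervalIntegrable φ volume 0 L) (c : ℂ) :
    ∀ᵐ x, x ∈ uIcc 0 L → HasDerivAt (fun x => c + ∫ y in (0 : ℝ)..x, φ y) (φ x) x := by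
  filter_upwards [hφ.ae_hasDerivAt_integral] with x hx hx'
  exact (hx hx' 0 left_mem_uIcc).const_add c

/-- The difference between `f g` and the primitive of the product-rule expression is absolutely
continuous with zero derivative a.e., hence constant. This replaces classical calculus, as
coefficients are merely bounded. -/
theorem mul (hf : IsPrim L f φ) (hg : IsPrim L g γ) :
    IsPrim L (fun x => f x * g x) (fun x => φ x * g x + f x * γ x) := by
  have huI : uIcc 0 L = Icc 0 L := uIcc_of_le hf.nonneg
  have hi : IntervalIntegrable (fun x => φ x * g x + f x * γ x) volume 0 L :=
    (hf.integrable.mul_continuousOn (huI ▸ hg.continuousOn)).add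
      (hg.integrable.continuousOn_mul (huI ▸ hf.continuousOn))
  refine ⟨hf.nonneg, hi, ?_⟩
  have hc (z : ℂ) : AbsolutelyContinuousOnInterval (fun _ : ℝ => z) 0 L :=
    (LipschitzWith.const z).lipschitzOnWith.absolutelyContinuousOnInterval (K := 0)
  have acf := (hc (f 0)).fun_add (absolutelyContinuousOnInterval_integral hf.integrable)
  have acg := (hc (g 0)).fun_add (absolutelyContinuousOnInterval_integral hg.integrable)
  have ac := (acf.fun_smul acg).fun_sub (absolutelyContinuousOnInterval_integral hi)
  obtain ⟨C, hC⟩ := ac.const_of_ae_hasDerivAt_zero (by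
    filter_upwards [ae_hasDerivAt hf.integrable (f 0), ae_hasDerivAt hg.integrable (g 0),
      hi.ae_hasDerivAt_integral] with x h1 h2 h3 hx
    have h4 := ((h1 hx).mul (h2 hx)).sub (h3 hx 0 left_mem_uIcc)
    rw [← hf.eq x (huI ▸ hx), ← hg.eq x (huI ▸ hx), sub_self] at h4
    exact h4)
  intro x hx
  have h1 := hC x (huI ▸ hx)
  have h0 := hC 0 left_mem_uIcc
  simp only [← hf.eq x hx, ← hg.eq x hx, smul_eq_mul] at h1
  simp only [intervalIntegral.integral_same, add_zero, sub_zero, smul_eq_mul] at h0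
  rw [h0, ← h1]
  ring

theorem of_hasDerivAt (hL : 0 ≤ L) (hd : ∀ x, HasDerivAt f (φ x) x) (hc : Continuous φ) :
    IsPrim L f φ := by
  refine ⟨hL, hc.intervalIntegrable _ _, fun x _ => ?_⟩
  rw [intervalIntegral.integral_eq_sub_of_hasDerivAt (fun y _ => hd y) (hc.intervalIntegrable _ _)]
  ring

theorem hasDerivWithinAt (hf : IsPrim L f φ) (hφ : ContinuousOn φ (Icc 0 L)) {x : ℝ}
    (hx : x ∈ Icc 0 L) : HasDerivWithinAt f (φ x) (Icc 0 L) x := by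
  have hL := hf.nonneg
  -- Extending `φ` by constants gives a continuous integrand on the line, so the fundamental theorem
  -- applies at the endpoints too.
  have hc : Continuous (IccExtend hL ((Icc 0 L).domRestrict φ)) :=
    (hφ.domRestrict).Icc_extend'
  have hd := ((hc.integral_hasStrictDerivAt 0 x).hasDerivAt.const_add (f 0)).hasDerivWithinAt
    (s := Icc 0 L)
  rw [IccExtend_of_mem hL _ hx] at hd
  refine hd.congr_of_mem (fun y hy => ?_) hx
  rw [hf.eq y hy]
  congr 1
  refine intervalIntegral.integral_congr fun z hz => ?_
  rw [uIcc_of_le hy.1] at hz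
  exact (IccExtend_of_mem hL ((Icc 0 L).domRestrict φ) ⟨hz.1, hz.2.trans hy.2⟩).symm

theorem reflect (hf : IsPrim L f φ) :
    IsPrim L (fun x => f (L - x)) (fun x => -φ (L - x)) := by
  refine ⟨hf.nonneg, ?_, fun x hx => ?_⟩
  · have := (hf.integrable.comp_sub_left L).symm.neg
    simpa [Pi.neg_def] using this
  · have h0 : L ∈ Icc 0 L := ⟨hf.nonneg, le_rfl⟩
    have hx' : L - x ∈ Icc 0 L := ⟨by linarith [hx.2], by linarith [hx.1]⟩
    have := hf.sub_eq h0 hx'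
    rw [intervalIntegral.integral_neg, intervalIntegral.integral_comp_sub_left, sub_zero,
      intervalIntegral.integral_symm (L) (L - x), ← this] 
    ring

end IsPrim

/-! ### Volterra operators on `C([0, L], ℂ)` -/

theorem intervalIntegrable_of_memLp_top {q : ℝ → ℂ} (hq : MemLp q ⊤ volume) (a b : ℝ) :
    IntervalIntegrable q volume a b :=
  intervalIntegrable_iff.2 <| ((hq.locallyIntegrable le_top).integrableOn_isCompact
    isCompact_uIcc).mono_set uIoc_subset_uIcc

theorem intervalIntegrable_mul_iccExtend {L : ℝ} (hL : 0 ≤ L) {q : ℝ → ℂ}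
    (hq : MemLp q ⊤ volume) (u : C(Icc (0 : ℝ) L, ℂ)) (a b : ℝ) :
    IntervalIntegrable (fun y => q y * IccExtend hL u y) volume a b :=
  (intervalIntegrable_of_memLp_top hq a b).mul_continuousOn
    (u.continuous.Icc_extend' (h := hL)).continuousOn

theorem norm_iccExtend_le {L : ℝ} (hL : 0 ≤ L) (u : C(Icc (0 : ℝ) L, ℂ)) (y : ℝ) :
    ‖IccExtend hL u y‖ ≤ ‖u‖ :=
  u.norm_coe_le_norm _

/-- The operator `u ↦ (x ↦ ∫₀ˣ q u)` on `C([0, L], ℂ)`. -/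
def volterra {L : ℝ} (hL : 0 ≤ L) {q : ℝ → ℂ} (hq : MemLp q ⊤ volume) :
    C(Icc (0 : ℝ) L, ℂ) →L[ℂ] C(Icc (0 : ℝ) L, ℂ) :=
  LinearMap.mkContinuous
    { toFun := fun u => ⟨fun x => ∫ y in (0 : ℝ)..x, q y * IccExtend hL u y,
        (intervalIntegral.continuous_primitive
          (intervalIntegrable_mul_iccExtend hL hq u) 0).comp continuous_subtype_val⟩
      map_add' := fun u v => by
        ext x
        simp only [ContinuousMap.coe_mk, ContinuousMap.add_apply]
        rw [← intervalIntegral.integral_add (intervalIntegrable_mul_iccExtend hL hq u _ _)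
          (intervalIntegrable_mul_iccExtend hL hq v _ _)]
        simp [IccExtend, mul_add]
      map_smul' := fun c u => by
        ext x
        simp only [ContinuousMap.coe_mk, ContinuousMap.smul_apply, RingHom.id_apply, smul_eq_mul]
        rw [← intervalIntegral.integral_const_mul]
        congr 1
        ext y
        simp [IccExtend]
        ring }
    (∫ y in (0 : ℝ)..L, ‖q y‖) fun u => by
      have hi (a b : ℝ) := (intervalIntegrable_of_memLp_top hq a b).norm
      have hpos : 0 ≤ ∫ y in (0 : ℝ)..L, ‖q y‖ :=
        intervalIntegral.integral_nonneg hL fun _ _ => norm_nonneg _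
      refine (ContinuousMap.norm_le _ (by positivity)).2 fun x => ?_
      calc ‖∫ y in (0 : ℝ)..x, q y * IccExtend hL u y‖
          ≤ ∫ y in (0 : ℝ)..x, ‖q y‖ * ‖u‖ := by
            refine intervalIntegral.norm_integral_le_of_norm_le x.2.1
              (Eventually.of_forall fun y _ => ?_) ((hi _ _).mul_const _)
            rw [norm_mul]
            gcongr
            exact norm_iccExtend_le hL u y
        _ = (∫ y in (0 : ℝ)..x, ‖q y‖) * ‖u‖ := intervalIntegral.integral_mul_const _ _
        _ ≤ _ := by
            gcongr
            exact intervalIntegral.integral_mono_interval le_rfl x.2.1 x.2.2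
              (Eventually.of_forall fun _ => norm_nonneg _) (hi _ _)

theorem volterra_apply {L : ℝ} (hL : 0 ≤ L) {q : ℝ → ℂ} (hq : MemLp q ⊤ volume)
    (u : C(Icc (0 : ℝ) L, ℂ)) (x : Icc (0 : ℝ) L) :
    volterra hL hq u x = ∫ y in (0 : ℝ)..x, q y * IccExtend hL u y := rfl

/-- Affine dependence on the coefficient is what makes the solution depend smoothly on the
perturbation parameter. -/
theorem volterra_add_smul {L : ℝ} (hL : 0 ≤ L) {q b : ℝ → ℂ} (hq : MemLp q ⊤ volume)
    (hb : MemLp b ⊤ volume) (t : ℂ) (h : MemLp (fun x => q x + t * b x) ⊤ volume) :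
    volterra hL h = volterra hL hq + t • volterra hL hb := by
  ext u x
  simp only [volterra_apply, add_apply, ContinuousMap.add_apply,
    smul_apply, ContinuousMap.smul_apply, smul_eq_mul]
  rw [← intervalIntegral.integral_const_mul, ← intervalIntegral.integral_add
    (intervalIntegrable_mul_iccExtend hL hq u _ _)
    ((intervalIntegrable_mul_iccExtend hL hb u _ _).const_mul t)]
  congr 1
  ext y
  ring

/-- Integrating the pointwise bound raises the power by one and extends the factorial; iteration
gives the decay of powers of Volterra operators. -/
theorem norm_volterra_apply_le {L : ℝ} (hL : 0 ≤ L) {q : ℝ → ℂ} (hq : MemLp q ⊤ volume)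
    {M C : ℝ} (hM : ∀ᵐ x, ‖q x‖ ≤ M) {k : ℕ} {u : C(Icc (0 : ℝ) L, ℂ)}
    (hu : ∀ x : Icc (0 : ℝ) L, ‖u x‖ ≤ C * (x : ℝ) ^ k / k.factorial) (x : Icc (0 : ℝ) L) :
    ‖volterra hL hq u x‖ ≤ M * C * (x : ℝ) ^ (k + 1) / (k + 1).factorial := by
  rw [volterra_apply]
  calc ‖∫ y in (0 : ℝ)..x, q y * IccExtend hL u y‖
      ≤ ∫ y in (0 : ℝ)..x, M * (C * y ^ k / k.factorial) := by
        refine intervalIntegral.norm_integral_le_of_norm_le x.2.1 ?_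
          (Continuous.intervalIntegrable (by fun_prop) _ _)
        filter_upwards [hM] with y hy hy'
        have hy2 : y ∈ Icc 0 L := ⟨hy'.1.le, hy'.2.trans x.2.2⟩
        rw [norm_mul, IccExtend_of_mem hL u hy2]
        have := hu ⟨y, hy2⟩
        have h0 : 0 ≤ M := (norm_nonneg _).trans hy
        gcongr
    _ = _ := by
        have : (fun y : ℝ => M * (C * y ^ k / k.factorial)) =
            fun y => (M * C / k.factorial) * y ^ k := by ext; ring
        rw [this, intervalIntegral.integral_const_mul, integral_pow, Nat.factorial_succ]
        push_cast
        field_simp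
        simp

theorem memLp_top_one : MemLp (fun _ : ℝ => (1 : ℂ)) ⊤ volume :=
  memLp_top_const 1

/-- The operator `u ↦ (x ↦ ∫₀ˣ ∫₀ˢ q u)` on `C([0, L], ℂ)`. -/
def volterraTwo {L : ℝ} (hL : 0 ≤ L) {q : ℝ → ℂ} (hq : MemLp q ⊤ volume) :
    C(Icc (0 : ℝ) L, ℂ) →L[ℂ] C(Icc (0 : ℝ) L, ℂ) :=
  volterra hL memLp_top_one * volterra hL hq

theorem norm_volterraTwo_pow_apply_le {L : ℝ} (hL : 0 ≤ L) {q : ℝ → ℂ} (hq : MemLp q ⊤ volume)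
    {M : ℝ} (hM : ∀ᵐ x, ‖q x‖ ≤ M) (u : C(Icc (0 : ℝ) L, ℂ)) (k : ℕ) (x : Icc (0 : ℝ) L) :
    ‖(volterraTwo hL hq ^ k) u x‖ ≤ M ^ k * ‖u‖ * (x : ℝ) ^ (2 * k) / (2 * k).factorial := by
  induction k generalizing x with
  | zero => simpa using u.norm_coe_le_norm x
  | succ k ih =>
    have h1 := norm_volterra_apply_le hL hq hM ih
    have h2 := norm_volterra_apply_le hL memLp_top_one (M := 1)
      (Eventually.of_forall fun x => by simp) h1 x
    have e : M ^ (k + 1) * ‖u‖ * (x : ℝ) ^ (2 * (k + 1)) / (2 * (k + 1)).factorial =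
      1 * (M * (M ^ k * ‖u‖)) * (x : ℝ) ^ (2 * k + 1 + 1) / (2 * k + 1 + 1).factorial := by
      rw [show 2 * (k + 1) = 2 * k + 1 + 1 by ring]
      ring
    rw [e, pow_succ']
    exact h2

theorem ae_norm_le_of_memLp_top {q : ℝ → ℂ} (hq : MemLp q ⊤ volume) :
    ∃ M : ℝ, 0 ≤ M ∧ ∀ᵐ x, ‖q x‖ ≤ M := by
  refine ⟨(eLpNorm q ⊤ volume).toReal, ENNReal.toReal_nonneg, ?_⟩
  filter_upwards [ae_le_eLpNormEssSup (f := q) (μ := volume)] with x hx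
  have h2 : eLpNorm q ⊤ volume ≠ ⊤ := hq.2.ne
  rw [eLpNorm_exponent_top] at h2 ⊢
  rw [← toReal_enorm]
  exact ENNReal.toReal_mono h2 hx

theorem norm_volterraTwo_pow_le {L : ℝ} (hL : 0 ≤ L) {q : ℝ → ℂ} (hq : MemLp q ⊤ volume)
    {M : ℝ} (hM0 : 0 ≤ M) (hM : ∀ᵐ x, ‖q x‖ ≤ M) (k : ℕ) :
    ‖volterraTwo hL hq ^ k‖ ≤ (M * L ^ 2) ^ k / k.factorial := by
  refine ContinuousLinearMap.opNorm_le_bound _ (by positivity) fun u => ?_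
  refine (ContinuousMap.norm_le _ (by positivity)).2 fun x => ?_
  refine (norm_volterraTwo_pow_apply_le hL hq hM u k x).trans ?_
  have hx0 := x.2.1
  have hx1 := x.2.2
  calc M ^ k * ‖u‖ * (x : ℝ) ^ (2 * k) / (2 * k).factorial
      ≤ M ^ k * ‖u‖ * L ^ (2 * k) / k.factorial := by
        -- `(2k)!` is weakened to `k!`, which suffices for decay.
        gcongr
        omega
    _ = _ := by rw [mul_pow, ← pow_mul]; ring

/-- The Neumann series inverts `1 - aᵏ`, which is the product of `1 - a` and a geometric sum
commuting with it. -/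
theorem isUnit_one_sub_of_norm_pow_lt_one {R : Type*} [NormedRing R] [CompleteSpace R] {a : R}
    {k : ℕ} (h : ‖a ^ k‖ < 1) : IsUnit (1 - a) := by
  have h1 : IsUnit (1 - a ^ k) := ⟨Units.oneSub _ h, rfl⟩
  rw [← mul_neg_geom_sum] at h1
  refine ((Commute.isUnit_mul_iff ?_).1 h1).1
  exact Commute.sum_right _ _ _ fun i _ =>
    ((Commute.one_left _).sub_left (Commute.refl a)).pow_right i

/-- Such a `T` is quasi-nilpotent, so no `κ` is exceptional: the Cauchy problem is solvable at every
frequency. -/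
theorem isUnit_one_add_smul_of_norm_pow_le {E : Type*} [NormedAddCommGroup E] [NormedSpace ℂ E]
    [CompleteSpace E] {T : E →L[ℂ] E} {c : ℝ} (h : ∀ k : ℕ, ‖T ^ k‖ ≤ c ^ k / k.factorial)
    (κ : ℂ) : IsUnit (1 + κ • T) := by
  have ht := FloorSemiring.tendsto_pow_div_factorial_atTop (‖κ‖ * c)
  obtain ⟨k, hk⟩ := (ht.eventually (gt_mem_nhds zero_lt_one)).exists
  have : ‖(-κ • T) ^ k‖ < 1 := by
    refine lt_of_le_of_lt ?_ hk
    rw [smul_pow, norm_smul, norm_pow, norm_neg, mul_pow, mul_div_assoc]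
    gcongr
    exact h k
  simpa using isUnit_one_sub_of_norm_pow_lt_one this

theorem isUnit_one_add_smul_volterraTwo {L : ℝ} (hL : 0 ≤ L) {q : ℝ → ℂ}
    (hq : MemLp q ⊤ volume) (κ : ℂ) : IsUnit (1 + κ • volterraTwo hL hq) := by
  obtain ⟨M, hM0, hM⟩ := ae_norm_le_of_memLp_top hq
  exact isUnit_one_add_smul_of_norm_pow_le (norm_volterraTwo_pow_le hL hq hM0 hM) κ

/-! ### The equation `u'' = -κ q u` on `[0, L]` -/

/-- `u` solves `u'' = -κ q u` on `[0, L]`, with derivative `w`. -/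
structure IsSol (L : ℝ) (κ : ℂ) (q u w : ℝ → ℂ) : Prop where
  fst : IsPrim L u w
  snd : IsPrim L w (fun x => -κ * (q x * u x))

/-- The path `x ↦ a + c x`. -/
def affinePath (L : ℝ) (a c : ℂ) : C(Icc (0 : ℝ) L, ℂ) :=
  a • 1 + c • ⟨fun x => ((x : ℝ) : ℂ), by fun_prop⟩

theorem affinePath_apply (L : ℝ) (a c : ℂ) (x : Icc (0 : ℝ) L) :
    affinePath L a c x = a + c * ((x : ℝ) : ℂ) := by
  simp [affinePath]

/-- The solution of `u'' = -κ q u` on `[0, L]` with `u(0) = a` and `u'(0) = c`. -/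
def solPath {L : ℝ} (hL : 0 ≤ L) {q : ℝ → ℂ} (hq : MemLp q ⊤ volume) (κ a c : ℂ) :
    C(Icc (0 : ℝ) L, ℂ) :=
  Ring.inverse (1 + κ • volterraTwo hL hq) (affinePath L a c)

theorem solPath_add {L : ℝ} (hL : 0 ≤ L) {q : ℝ → ℂ} (hq : MemLp q ⊤ volume) (κ a c : ℂ) :
    solPath hL hq κ a c + κ • volterraTwo hL hq (solPath hL hq κ a c) = affinePath L a c := by
  have h := Ring.mul_inverse_cancel _ (isUnit_one_add_smul_volterraTwo hL hq κ)
  have h2 := congrArg (fun T => T (affinePath L a c)) h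
  exact h2

theorem eq_solPath {L : ℝ} (hL : 0 ≤ L) {q : ℝ → ℂ} (hq : MemLp q ⊤ volume) {κ a c : ℂ}
    {v : C(Icc (0 : ℝ) L, ℂ)} (hv : v + κ • volterraTwo hL hq v = affinePath L a c) :
    v = solPath hL hq κ a c := by
  have h := Ring.inverse_mul_cancel _ (isUnit_one_add_smul_volterraTwo hL hq κ)
  have h2 := congrArg (fun T => T v) h
  rw [solPath, ← hv]
  exact h2.symm

theorem volterraTwo_apply {L : ℝ} (hL : 0 ≤ L) {q : ℝ → ℂ} (hq : MemLp q ⊤ volume)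
    (v : C(Icc (0 : ℝ) L, ℂ)) (x : Icc (0 : ℝ) L) :
    volterraTwo hL hq v x = ∫ s in (0 : ℝ)..x, ∫ y in (0 : ℝ)..s, q y * IccExtend hL v y := by
  change volterra hL memLp_top_one (volterra hL hq v) x = _
  rw [volterra_apply]
  refine intervalIntegral.integral_congr fun s hs => ?_
  rw [uIcc_of_le x.2.1] at hs
  have hs' : s ∈ Icc 0 L := ⟨hs.1, hs.2.trans x.2.2⟩
  simp only [one_mul]
  rw [IccExtend_of_mem hL _ hs', volterra_apply]

theorem isSol_solPath {L : ℝ} (hL : 0 ≤ L) {q : ℝ → ℂ} (hq : MemLp q ⊤ volume) (κ a c : ℂ) :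
    IsSol L κ q (IccExtend hL (solPath hL hq κ a c))
      (fun x => c - κ * ∫ y in (0 : ℝ)..x, q y * IccExtend hL (solPath hL hq κ a c) y) := by
  set v := solPath hL hq κ a c with hv
  have hint := intervalIntegrable_mul_iccExtend hL hq v
  have hcont : Continuous fun x => ∫ y in (0 : ℝ)..x, q y * IccExtend hL v y :=
    intervalIntegral.continuous_primitive hint 0
  have key : ∀ x ∈ Icc 0 L, IccExtend hL v x =
      a + ∫ s in (0 : ℝ)..x, (c - κ * ∫ y in (0 : ℝ)..s, q y * IccExtend hL v y) := by
    intro x hx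
    have h := congrArg (fun z : C(Icc (0 : ℝ) L, ℂ) => z ⟨x, hx⟩) (solPath_add hL hq κ a c)
    simp only [← hv, ContinuousMap.add_apply, ContinuousMap.smul_apply, affinePath_apply,
      volterraTwo_apply, smul_eq_mul] at h
    rw [intervalIntegral.integral_sub intervalIntegrable_const
      ((hcont.intervalIntegrable _ _).const_mul κ),
      intervalIntegral.integral_const_mul, intervalIntegral.integral_const,
      IccExtend_of_mem hL _ hx]
    simp only [sub_zero, Complex.real_smul]
    linear_combination h
  refine ⟨⟨hL, ?_, fun x hx => ?_⟩, ⟨hL, ?_, fun x hx => ?_⟩⟩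
  · exact (continuous_const.sub (continuous_const.mul hcont)).intervalIntegrable _ _
  · rw [key x hx, key 0 ⟨le_rfl, hL⟩, intervalIntegral.integral_same, add_zero]
  · exact (hint _ _).const_mul _
  · rw [intervalIntegral.integral_const_mul, intervalIntegral.integral_same]
    ring

theorem iccExtend_solPath_zero {L : ℝ} (hL : 0 ≤ L) {q : ℝ → ℂ} (hq : MemLp q ⊤ volume)
    (κ a c : ℂ) : IccExtend hL (solPath hL hq κ a c) 0 = a := by
  have h0 : (0 : ℝ) ∈ Icc 0 L := ⟨le_rfl, hL⟩
  have h := congrArg (fun z : C(Icc (0 : ℝ) L, ℂ) => z ⟨0, h0⟩) (solPath_add hL hq κ a c)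
  simp only [ContinuousMap.add_apply, ContinuousMap.smul_apply, affinePath_apply,
    volterraTwo_apply, smul_eq_mul, intervalIntegral.integral_same] at h
  rw [IccExtend_of_mem hL _ h0]
  simpa using h

namespace IsSol

variable {L : ℝ} {κ : ℂ} {q q₁ q₂ u w u₁ w₁ u₂ w₂ : ℝ → ℂ}

/-- Integrating the equation twice gives the integral equation that defines `solPath`, and its
operator is injective. -/
theorem eq_iccExtend (h : IsSol L κ q u w) (hL : 0 ≤ L) (hq : MemLp q ⊤ volume) {x : ℝ}
    (hx : x ∈ Icc 0 L) : u x = IccExtend hL (solPath hL hq κ (u 0) (w 0)) x := by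
  let v : C(Icc (0 : ℝ) L, ℂ) := ⟨fun x => u x, h.fst.continuousOn.domRestrict⟩
  have hvu : ∀ y ∈ Icc 0 L, IccExtend hL v y = u y := fun y hy => by
    rw [IccExtend_of_mem hL _ hy]; rfl
  have hw : ∀ s ∈ Icc 0 L, w s = w 0 - κ * ∫ y in (0 : ℝ)..s, q y * IccExtend hL v y := by
    intro s hs
    rw [h.snd.eq s hs, intervalIntegral.integral_const_mul]
    have : ∫ y in (0 : ℝ)..s, q y * u y = ∫ y in (0 : ℝ)..s, q y * IccExtend hL v y := by
      refine intervalIntegral.integral_congr fun y hy => ?_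
      rw [uIcc_of_le hs.1] at hy
      simp only [hvu y ⟨hy.1, hy.2.trans hs.2⟩]
    rw [this]
    ring
  have hcont : Continuous fun x => ∫ y in (0 : ℝ)..x, q y * IccExtend hL v y :=
    intervalIntegral.continuous_primitive (intervalIntegrable_mul_iccExtend hL hq v) 0
  have : v = solPath hL hq κ (u 0) (w 0) := by
    refine eq_solPath hL hq ?_
    ext x
    simp only [ContinuousMap.add_apply, ContinuousMap.smul_apply, affinePath_apply,
      volterraTwo_apply, smul_eq_mul]
    have e1 : v x = u x := rfl
    have e2 : ∫ y in (0 : ℝ)..x, w y =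
        ∫ s in (0 : ℝ)..x, (w 0 - κ * ∫ y in (0 : ℝ)..s, q y * IccExtend hL v y) := by
      refine intervalIntegral.integral_congr fun y hy => ?_
      rw [uIcc_of_le x.2.1] at hy
      exact hw y ⟨hy.1, hy.2.trans x.2.2⟩
    rw [e1, h.fst.eq x x.2, e2, intervalIntegral.integral_sub intervalIntegrable_const
      ((hcont.intervalIntegrable _ _).const_mul κ),
      intervalIntegral.integral_const_mul, intervalIntegral.integral_const]
    simp only [sub_zero, Complex.real_smul]
    ring
  rw [← this, hvu x hx]

theorem snd_eq (h : IsSol L κ q u w) {x : ℝ} (hx : x ∈ Icc 0 L) :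
    w x = w 0 - κ * ∫ y in (0 : ℝ)..x, q y * u y := by
  rw [h.snd.eq x hx, intervalIntegral.integral_const_mul]
  ring

theorem const_mul (h : IsSol L κ q u w) (c : ℂ) :
    IsSol L κ q (fun x => c * u x) (fun x => c * w x) :=
  ⟨h.fst.const_mul c, (h.snd.const_mul c).congr fun x _ => by ring⟩

/-- Solutions are determined by their Cauchy data at `0`. -/
theorem unique (h₁ : IsSol L κ q u₁ w₁) (h₂ : IsSol L κ q u₂ w₂) (hq : MemLp q ⊤ volume)
    (hu : u₁ 0 = u₂ 0) (hw : w₁ 0 = w₂ 0) {x : ℝ} (hx : x ∈ Icc 0 L) :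
    u₁ x = u₂ x ∧ w₁ x = w₂ x := by
  have hL := h₁.fst.nonneg
  have key : ∀ y ∈ Icc 0 L, u₁ y = u₂ y := fun y hy => by
    rw [h₁.eq_iccExtend hL hq hy, h₂.eq_iccExtend hL hq hy, hu, hw]
  refine ⟨key x hx, ?_⟩
  rw [h₁.snd_eq hx, h₂.snd_eq hx, hw]
  congr 2
  refine intervalIntegral.integral_congr fun y hy => ?_
  rw [uIcc_of_le hx.1] at hy
  simp only [key y ⟨hy.1, hy.2.trans hx.2⟩]

/-- Two coefficients are allowed: equal ones give a conserved quantity, different ones give the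
first variation in the index. -/
theorem wronskian (h₁ : IsSol L κ q₁ u₁ w₁) (h₂ : IsSol L κ q₂ u₂ w₂) :
    IsPrim L (fun x => w₁ x * u₂ x - u₁ x * w₂ x)
      (fun x => -κ * ((q₁ x - q₂ x) * (u₁ x * u₂ x))) :=
  ((h₁.snd.mul h₂.fst).sub (h₁.fst.mul h₂.snd)).congr fun x _ => by ring

theorem eq_zero_of_initial (h : IsSol L κ q u w) (hq : MemLp q ⊤ volume) (hu : u 0 = 0)
    (hw : w 0 = 0) {x : ℝ} (hx : x ∈ Icc 0 L) : u x = 0 ∧ w x = 0 := by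
  have h2 : IsSol L κ q (fun _ => 0) (fun _ => 0) := by
    simpa using h.const_mul 0
  exact h.unique h2 hq hu hw hx

/-- A solution whose Cauchy data vanish at some point has vanishing Cauchy data at `0`. -/
theorem initial_eq_zero (h : IsSol L κ q u w) (hq : MemLp q ⊤ volume) {x : ℝ}
    (hx : x ∈ Icc 0 L) (hu : u x = 0) (hw : w x = 0) : u 0 = 0 ∧ w 0 = 0 := by
  have hL := h.fst.nonneg
  -- The Wronskian with the solution of data `(a, c)` is constant, and it vanishes at `x`.
  have key (a c : ℂ) : w 0 * a - u 0 * c = 0 := by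
    have hv := h.wronskian (isSol_solPath hL hq κ a c)
    have := hv.eq x hx
    simp only [hu, hw, sub_self, zero_mul, mul_zero, intervalIntegral.integral_zero, add_zero,
      intervalIntegral.integral_same, sub_zero, iccExtend_solPath_zero] at this
    exact this.symm
  constructor
  · simpa using key 0 1
  · simpa using key 1 0

theorem reflect (h : IsSol L κ q u w) (hq : ∀ᵐ x, q x = q (L - x)) :
    IsSol L κ q (fun x => u (L - x)) (fun x => -w (L - x)) := by
  refine ⟨h.fst.reflect, ?_⟩
  have := (h.snd.reflect).const_mul (-1)
  simp only [neg_mul, one_mul, neg_neg] at this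
  refine this.congr_ae ?_
  filter_upwards [hq] with x hx _
  rw [← hx]
  ring

end IsSol

/-! ### Outgoing solutions and the characteristic function -/

/-- The solution with the outgoing Cauchy data `(1, -iω)` at `0`. -/
def outPath {L : ℝ} (hL : 0 ≤ L) {q : ℝ → ℂ} (hq : MemLp q ⊤ volume) (ω : ℂ) :
    C(Icc (0 : ℝ) L, ℂ) :=
  solPath hL hq (ω ^ 2) 1 (-(Complex.I * ω))

/-- The characteristic function `u'(L) - iω u(L)`, with `u` the solution satisfying the outgoing
condition at `0`. -/
def charFun {L : ℝ} (hL : 0 ≤ L) {q : ℝ → ℂ} (hq : MemLp q ⊤ volume) (ω : ℂ) : ℂ :=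
  -(Complex.I * ω) - ω ^ 2 * volterra hL hq (outPath hL hq ω) ⟨L, hL, le_rfl⟩ -
    Complex.I * ω * outPath hL hq ω ⟨L, hL, le_rfl⟩

/-- `u` solves `u'' = -ω² q u` on `[0, L]` with `u(0) = 1`, is outgoing at both ends, and has
derivative `w`. -/
structure IsMode (L : ℝ) (ω : ℂ) (q u w : ℝ → ℂ) : Prop where
  sol : IsSol L (ω ^ 2) q u w
  one : u 0 = 1
  left : w 0 = -(Complex.I * ω)
  right : w L = Complex.I * ω * u L

/-- The definition writes `u'(L)` as `u'(0) - ω² ∫ q u`, so that it is built from bounded operators;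
here the derivative is recovered. -/
theorem charFun_eq {L : ℝ} (hL : 0 ≤ L) {q u w : ℝ → ℂ} (hq : MemLp q ⊤ volume) {ω : ℂ}
    (h : IsSol L (ω ^ 2) q u w) (h0 : u 0 = 1) (h1 : w 0 = -(Complex.I * ω)) :
    charFun hL hq ω = w L - Complex.I * ω * u L := by
  have hLL : L ∈ Icc 0 L := ⟨hL, le_rfl⟩
  have key : ∀ y ∈ Icc 0 L, u y = IccExtend hL (outPath hL hq ω) y := fun y hy => by
    rw [h.eq_iccExtend hL hq hy, h0, h1, outPath]
  rw [h.snd_eq hLL, charFun, volterra_apply, h1, key L hLL, IccExtend_of_mem hL _ hLL]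
  have : ∫ y in (0 : ℝ)..L, q y * u y =
      ∫ y in (0 : ℝ)..L, q y * IccExtend hL (outPath hL hq ω) y := by
    refine intervalIntegral.integral_congr fun y hy => ?_
    rw [uIcc_of_le hL] at hy
    simp only [key y hy]
  rw [this]

theorem exists_isSol_outPath {L : ℝ} (hL : 0 ≤ L) {q : ℝ → ℂ} (hq : MemLp q ⊤ volume) (ω : ℂ) :
    ∃ w, IsSol L (ω ^ 2) q (IccExtend hL (outPath hL hq ω)) w ∧
      IccExtend hL (outPath hL hq ω) 0 = 1 ∧ w 0 = -(Complex.I * ω) :=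
  ⟨_, isSol_solPath hL hq _ _ _, iccExtend_solPath_zero hL hq _ _ _, by simp⟩

theorem exists_isMode_of_charFun_eq_zero {L : ℝ} (hL : 0 ≤ L) {q : ℝ → ℂ}
    (hq : MemLp q ⊤ volume) {ω : ℂ} (h : charFun hL hq ω = 0) : ∃ u w, IsMode L ω q u w := by
  obtain ⟨w, h1, h2, h3⟩ := exists_isSol_outPath hL hq ω
  rw [charFun_eq hL hq h1 h2 h3] at h
  exact ⟨_, w, h1, h2, h3, sub_eq_zero.1 h⟩

theorem IsMode.charFun_eq_zero {L : ℝ} (hL : 0 ≤ L) {q u w : ℝ → ℂ}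
    (hq : MemLp q ⊤ volume) {ω : ℂ} (h : IsMode L ω q u w) : charFun hL hq ω = 0 := by
  rw [charFun_eq hL hq h.sol h.one h.left, h.right, sub_self]

/-! ### Scattering resonances as zeros of the characteristic function -/

/-- The squared index, as a complex-valued function. -/
def sqIndex (n : ℝ → ℝ) (x : ℝ) : ℂ := (n x : ℂ) ^ 2

theorem memLp_sqIndex {L a b : ℝ} {n : ℝ → ℝ} (hn : n ∈ Admissible L a b) :
    MemLp (sqIndex n) ⊤ volume := by
  obtain ⟨hm, h1, h2⟩ := hn
  refine memLp_top_of_bound ?_ ((1 + |a| + |b|) ^ 2) ?_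
  · exact ((Complex.measurable_ofReal.comp_aemeasurable hm).pow_const 2).aestronglyMeasurable
  · filter_upwards [h1, h2] with x hx1 hx2
    rw [sqIndex, norm_pow, Complex.norm_real, Real.norm_eq_abs]
    have : |n x| ≤ 1 + |a| + |b| := by
      by_cases hx : x ∈ Icc 0 L
      · have := hx2 hx
        rw [abs_le]
        constructor <;>
          linarith [neg_abs_le a, le_abs_self b, abs_nonneg a, abs_nonneg b]
      · rw [hx1 hx, abs_one]
        linarith [abs_nonneg a, abs_nonneg b]
    gcongr

theorem green_mul_sq {ω : ℂ} (hω : ω ≠ 0) (r : ℝ) :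
    ω ^ 2 * green r ω = Complex.I * ω / 2 * Complex.exp (Complex.I * ω * r) := by
  rw [green, mul_inv, mul_inv, Complex.inv_I]
  field_simp

theorem exp_mul_exp_neg (ω : ℂ) (x : ℝ) :
    Complex.exp (Complex.I * ω * x) * Complex.exp (-(Complex.I * ω * x)) = 1 := by
  rw [← Complex.exp_add, add_neg_cancel, Complex.exp_zero]

theorem intervalIntegrable_exp_mul {L : ℝ} {h : ℝ → ℂ} (hh : IntervalIntegrable h volume 0 L)
    (α : ℂ) : IntervalIntegrable (fun y : ℝ => Complex.exp (α * y) * h y) volume 0 L :=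
  hh.continuousOn_mul (by fun_prop)

/-- The Green's potential of `h`, split at the projection of `x` to `[0, L]`. -/
theorem green_integral {L : ℝ} (hL : 0 ≤ L) {ω : ℂ} (hω : ω ≠ 0) {h : ℝ → ℂ}
    (hh : IntervalIntegrable h volume 0 L) (x : ℝ) :
    ω ^ 2 * ∫ y in Icc 0 L, green |x - y| ω * h y =
      Complex.I * ω / 2 *
        (Complex.exp (Complex.I * ω * x) *
            (∫ y in (0 : ℝ)..max 0 (min x L), Complex.exp (-(Complex.I * ω) * y) * h y) +
          Complex.exp (-(Complex.I * ω * x)) *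
            ∫ y in max 0 (min x L)..L, Complex.exp (Complex.I * ω * y) * h y) := by
  set p := max 0 (min x L) with hp
  have hp0 : 0 ≤ p := le_max_left _ _
  have hpL : p ≤ L := max_le hL (min_le_right _ _)
  have hpm : p ∈ uIcc 0 L := by rw [uIcc_of_le hL]; exact ⟨hp0, hpL⟩
  have i1 (α : ℂ) : IntervalIntegrable (fun y : ℝ => Complex.exp (α * y) * h y) volume 0 p :=
    (intervalIntegrable_exp_mul hh α).mono_set (uIcc_subset_uIcc left_mem_uIcc hpm)
  have i2 (α : ℂ) : IntervalIntegrable (fun y : ℝ => Complex.exp (α * y) * h y) volume p L :=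
    (intervalIntegrable_exp_mul hh α).mono_set (uIcc_subset_uIcc hpm right_mem_uIcc)
  rw [integral_Icc_eq_integral_Ioc, ← intervalIntegral.integral_of_le hL,
    ← intervalIntegral.integral_const_mul]
  have e1 : EqOn (fun y : ℝ => Complex.I * ω / 2 * Complex.exp (Complex.I * ω * x) *
      (Complex.exp (-(Complex.I * ω) * y) * h y))
      (fun y => ω ^ 2 * (green |x - y| ω * h y)) (uIoc 0 p) := by
    intro y hy
    rw [uIoc_of_le hp0] at hy
    have hyx : y ≤ x := by
      rcases le_max_iff.1 hy.2 with h' | h'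
      · exact absurd hy.1 (not_lt.2 h')
      · exact h'.trans (min_le_left _ _)
    simp only
    rw [← mul_assoc (ω ^ 2), green_mul_sq hω, abs_of_nonneg (sub_nonneg.2 hyx), Complex.ofReal_sub,
      mul_sub, sub_eq_add_neg, Complex.exp_add, neg_mul]
    ring
  have e2 : EqOn (fun y : ℝ => Complex.I * ω / 2 * Complex.exp (-(Complex.I * ω * x)) *
      (Complex.exp (Complex.I * ω * y) * h y))
      (fun y => ω ^ 2 * (green |x - y| ω * h y)) (uIoc p L) := by
    intro y hy
    rw [uIoc_of_le hpL] at hy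
    have hyx : x ≤ y := by
      have h1 : min x L < y := (le_max_right _ _).trans_lt hy.1
      rcases min_lt_iff.1 h1 with h' | h'
      · exact h'.le
      · exact absurd hy.2 (not_le.2 h')
    simp only
    rw [← mul_assoc (ω ^ 2), green_mul_sq hω, abs_of_nonpos (sub_nonpos.2 hyx), Complex.ofReal_neg,
      Complex.ofReal_sub, neg_sub, mul_sub, sub_eq_add_neg, Complex.exp_add]
    ring
  have j1 := (((i1 (-(Complex.I * ω))).const_mul
    (Complex.I * ω / 2 * Complex.exp (Complex.I * ω * x)))).congr e1
  have j2 := (((i2 (Complex.I * ω)).const_mul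
    (Complex.I * ω / 2 * Complex.exp (-(Complex.I * ω * x))))).congr e2
  rw [← intervalIntegral.integral_add_adjacent_intervals j1 j2,
    ← intervalIntegral.integral_congr_ae (Eventually.of_forall e1),
    ← intervalIntegral.integral_congr_ae (Eventually.of_forall e2),
    intervalIntegral.integral_const_mul, intervalIntegral.integral_const_mul]
  ring

theorem isPrim_exp {L : ℝ} (hL : 0 ≤ L) (α : ℂ) :
    IsPrim L (fun x => Complex.exp (α * x)) (fun x => α * Complex.exp (α * x)) := by
  refine IsPrim.of_hasDerivAt hL (fun x => ?_) (by fun_prop)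
  have h1 : HasDerivAt (fun x : ℝ => α * (x : ℂ)) α x := by
    simpa using (Complex.ofRealCLM.hasDerivAt (x := x)).const_mul α
  simpa [mul_comm] using h1.cexp

theorem isPrim_integral {L : ℝ} (hL : 0 ≤ L) {φ : ℝ → ℂ} (hφ : IntervalIntegrable φ volume 0 L) :
    IsPrim L (fun x => ∫ y in (0 : ℝ)..x, φ y) φ :=
  ⟨hL, hφ, fun x _ => by simp⟩

theorem isPrim_integral_right {L : ℝ} (hL : 0 ≤ L) {φ : ℝ → ℂ}
    (hφ : IntervalIntegrable φ volume 0 L) :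
    IsPrim L (fun x => ∫ y in x..L, φ y) (fun x => -φ x) := by
  refine ⟨hL, hφ.neg, fun x hx => ?_⟩
  have hx' : x ∈ uIcc 0 L := by rwa [uIcc_of_le hL]
  rw [intervalIntegral.integral_neg, ← intervalIntegral.integral_add_adjacent_intervals
    (hφ.mono_set (uIcc_subset_uIcc left_mem_uIcc hx'))
    (hφ.mono_set (uIcc_subset_uIcc hx' right_mem_uIcc))]
  ring

/-- The given function is only locally integrable; the Green potential on the right-hand side
supplies a representative `U` with primitives, and its derivative `W`. The outgoing conditions hold
because one of the two partial integrals is empty at each endpoint. -/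
theorem exists_isMode_of_mem_res {L : ℝ} (hL : 0 ≤ L) {n : ℝ → ℝ}
    (hq : MemLp (sqIndex n) ⊤ volume) {ω : ℂ} (hω : ω ≠ 0) (hres : ω ∈ Res L n) :
    ∃ u w, IsMode L ω (sqIndex n) u w := by
  obtain ⟨u, hu⟩ := hres
  set h : ℝ → ℂ := fun y => (sqIndex n y - 1) * u y with hh
  have hint : IntervalIntegrable h volume 0 L := by
    have h1 : MemLp (fun y => sqIndex n y - 1) ⊤ (volume.restrict (uIoc 0 L)) :=
      (hq.sub memLp_top_one).restrict _
    have h2 : Integrable u (volume.restrict (uIoc 0 L)) :=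
      (hu.locallyIntegrable.integrableOn_isCompact isCompact_uIcc).mono_set uIoc_subset_uIcc
    rw [intervalIntegrable_iff]
    exact h2.mul_of_top_right h1
  set α : ℂ := Complex.I * ω with hα
  have hα2 : α * α = -ω ^ 2 := by
    rw [hα, mul_mul_mul_comm, Complex.I_mul_I]; ring
  set E : ℝ → ℂ := fun x => Complex.exp (α * x) with hE
  set E' : ℝ → ℂ := fun x => Complex.exp (-α * x) with hE'
  have hEE (x : ℝ) : E x * E' x = 1 := by
    simp only [hE, hE', neg_mul]; exact exp_mul_exp_neg ω x
  set A : ℝ → ℂ := fun x => ∫ y in (0 : ℝ)..x, E' y * h y with hA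
  set B : ℝ → ℂ := fun x => ∫ y in x..L, E y * h y with hB
  have pE : IsPrim L E (fun x => α * E x) := isPrim_exp hL α
  have pE' : IsPrim L E' (fun x => -α * E' x) := isPrim_exp hL (-α)
  have pA : IsPrim L A (fun x => E' x * h x) :=
    isPrim_integral hL (intervalIntegrable_exp_mul hint _)
  have pB : IsPrim L B (fun x => -(E x * h x)) :=
    isPrim_integral_right hL (intervalIntegrable_exp_mul hint _)
  set U : ℝ → ℂ := fun x => α / 2 * (E x * A x + E' x * B x) with hU
  set W : ℝ → ℂ := fun x => α * α / 2 * (E x * A x - E' x * B x) with hW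
  have eqU : ∀ᵐ x, x ∈ Icc 0 L → U x = u x := by
    filter_upwards [hu.equation] with x hx hxI
    have hp : max 0 (min x L) = x := by rw [min_eq_left hxI.2, max_eq_right hxI.1]
    have := green_integral hL hω hint x
    rw [hp] at this
    rw [hx]
    simp only [mul_assoc] at this ⊢
    rw [show (∫ y in Icc 0 L, green |x - y| ω * (((n y : ℂ) ^ 2 - 1) * u y)) =
      ∫ y in Icc 0 L, green |x - y| ω * h y from rfl, this]
    simp only [hU, hE, hE', hA, hB, hα, mul_assoc, neg_mul]
  have pU : IsPrim L U W := by
    refine (((pE.mul pA).add (pE'.mul pB)).const_mul (α / 2)).congr fun x _ => ?_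
    simp only [hW]
    linear_combination (α / 2 * h x - α / 2 * h x) * hEE x
  have pW : IsPrim L W (fun x => -ω ^ 2 * (sqIndex n x * U x)) := by
    refine (((pE.mul pA).sub (pE'.mul pB)).const_mul (α * α / 2)).congr_ae ?_
    filter_upwards [eqU] with x hx hxI
    have h1 : h x = (sqIndex n x - 1) * U x := by rw [hx hxI]
    -- The `E E' h` terms cancelled in `U'`; here they add up to the source `α² h`, which changes
    -- `α² U` into `-ω² n² U`.
    have h2 : U x = α / 2 * (E x * A x + E' x * B x) := rfl
    linear_combination (α * α * h x) * hEE x - α * α * h2 + (α * α) * h1 +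
      (sqIndex n x * U x) * hα2
  have hUW : IsSol L (ω ^ 2) (sqIndex n) U W := ⟨pU, pW⟩
  have hl : W 0 = -α * U 0 := by
    simp only [hW, hU, hA, intervalIntegral.integral_same]; ring
  have hr : W L = α * U L := by
    simp only [hW, hU, hB, intervalIntegral.integral_same]; ring
  -- Otherwise all Cauchy data at `0` vanish, so `u = 0` a.e. on `[0, L]`, and the integral equation
  -- makes it vanish a.e. on the line.
  have hU0 : U 0 ≠ 0 := by
    intro h0
    refine hu.nontrivial ?_
    have hz := fun x hx => (hUW.eq_zero_of_initial hq h0 (by rw [hl, h0, mul_zero]) (x := x) hx).1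
    filter_upwards [hu.equation] with x hx
    rw [hx]
    have : ∫ y in Icc 0 L, green |x - y| ω * ((n y : ℂ) ^ 2 - 1) * u y =
        ∫ y in Icc 0 L, (0 : ℂ) := by
      refine setIntegral_congr_ae measurableSet_Icc ?_
      filter_upwards [eqU] with y hy hyI
      rw [← hy hyI, hz y hyI, mul_zero]
    rw [this]
    simp
  refine ⟨_, _, hUW.const_mul (U 0)⁻¹, inv_mul_cancel₀ hU0, ?_, ?_⟩
  · simp only [hl]
    rw [mul_left_comm, inv_mul_cancel₀ hU0, mul_one]
  · simp only [hr]
    ring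

/-- Variation of parameters: `e^{-iωx} (w + iωu)` vanishes at `0` and `e^{iωx} (w - iωu)` at `L`, so
integrating their derivatives yields the Green representation on `[0, L]`. The potential itself
extends the mode to the line. -/
theorem IsMode.mem_res {L : ℝ} (hL : 0 < L) {n : ℝ → ℝ} (hq : MemLp (sqIndex n) ⊤ volume) {ω : ℂ}
    (hω : ω ≠ 0) {u w : ℝ → ℂ} (hm : IsMode L ω (sqIndex n) u w) : ω ∈ Res L n := by
  set α : ℂ := Complex.I * ω with hα
  have hα2 : α * α = -ω ^ 2 := by
    rw [hα, mul_mul_mul_comm, Complex.I_mul_I]; ring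
  have hα0 : α ≠ 0 := mul_ne_zero Complex.I_ne_zero hω
  set h : ℝ → ℂ := fun y => (sqIndex n y - 1) * u y with hh
  have hint : IntervalIntegrable h volume 0 L :=
    (intervalIntegrable_of_memLp_top (hq.sub memLp_top_one) 0 L).mul_continuousOn
      (by rw [uIcc_of_le hL.le]; exact hm.sol.fst.continuousOn)
  set E : ℝ → ℂ := fun x => Complex.exp (α * x) with hE
  set E' : ℝ → ℂ := fun x => Complex.exp (-α * x) with hE'
  have hEE (x : ℝ) : E x * E' x = 1 := by
    simp only [hE, hE', neg_mul]; exact exp_mul_exp_neg ω x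
  have pE : IsPrim L E (fun x => α * E x) := isPrim_exp hL.le α
  have pE' : IsPrim L E' (fun x => -α * E' x) := isPrim_exp hL.le (-α)
  have pa : IsPrim L (fun x => E' x * (w x + α * u x)) (fun x => α * α * (E' x * h x)) := by
    refine (pE'.mul (hm.sol.snd.add (hm.sol.fst.const_mul α))).congr fun x _ => ?_
    simp only [hh]
    linear_combination (-(E' x * sqIndex n x * u x)) * hα2
  have pb : IsPrim L (fun x => E x * (w x - α * u x)) (fun x => α * α * (E x * h x)) := by
    refine (pE.mul (hm.sol.snd.sub (hm.sol.fst.const_mul α))).congr fun x _ => ?_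
    simp only [hh]
    linear_combination (-(E x * sqIndex n x * u x)) * hα2
  set U : ℝ → ℂ := fun x => ω ^ 2 * ∫ y in Icc 0 L, green |x - y| ω * h y with hU
  have eqU : ∀ x ∈ Icc 0 L, U x = u x := by
    intro x hxI
    have hp : max 0 (min x L) = x := by rw [min_eq_left hxI.2, max_eq_right hxI.1]
    have h1 := green_integral hL.le hω hint x
    rw [hp] at h1
    have h2 := pa.sub_eq ⟨le_rfl, hL.le⟩ hxI
    have h3 := pb.sub_eq hxI ⟨hL.le, le_rfl⟩
    rw [intervalIntegral.integral_const_mul] at h2 h3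
    rw [hm.left, hm.one] at h2
    rw [hm.right] at h3
    refine mul_left_cancel₀ hα0 ?_
    have h4 : Complex.exp (-(Complex.I * ω * x)) = E' x := by simp only [hE', neg_mul, hα]
    rw [h4] at h1
    simp only [hU]
    rw [h1]
    change α * (α / 2 * (E x * (∫ y in (0 : ℝ)..x, E' y * h y) +
      E' x * ∫ y in x..L, E y * h y)) = α * u x
    linear_combination (-(E x) / 2) * h2 - E' x / 2 * h3 + α * u x * hEE x
  have hcont : Continuous U := by
    have : U = fun x => _ := funext fun x => green_integral hL.le hω hint x
    rw [this]
    have hpc : Continuous fun x : ℝ => max 0 (min x L) := by fun_prop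
    have hpm : ∀ x : ℝ, max 0 (min x L) ∈ Icc 0 L :=
      fun x => ⟨le_max_left _ _, max_le hL.le (min_le_right _ _)⟩
    have c1 : Continuous fun x : ℝ => ∫ y in (0 : ℝ)..max 0 (min x L),
        Complex.exp (-(Complex.I * ω) * y) * h y :=
      (isPrim_integral hL.le (intervalIntegrable_exp_mul hint _)).continuousOn.comp_continuous
        hpc hpm
    have c2 : Continuous fun x : ℝ => ∫ y in max 0 (min x L)..L,
        Complex.exp (Complex.I * ω * y) * h y :=
      (isPrim_integral_right hL.le (intervalIntegrable_exp_mul hint _)).continuousOn.comp_continuous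
        hpc hpm
    fun_prop
  refine ⟨U, hcont.locallyIntegrable, fun h0 => ?_, Eventually.of_forall fun x => ?_⟩
  · have : U = 0 := (hcont.ae_eq_iff_eq volume continuous_zero).1 h0
    have h1 := eqU 0 ⟨le_rfl, hL.le⟩
    rw [this, hm.one] at h1
    exact zero_ne_one h1
  · simp only [hU, mul_assoc]
    congr 1
    refine setIntegral_congr_fun measurableSet_Icc fun y hy => ?_
    have := eqU y hy
    simp only [hU] at this
    simp only [this]
    rfl

/-! ### Zeros of complex-valued functions with nonvanishing flux -/

theorem eq_zero_of_frequently_eq_zero {f : ℝ → ℝ} {f' x : ℝ} {s : Set ℝ}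
    (hd : HasDerivWithinAt f f' s x) (hf : ∃ᶠ y in 𝓝[s \ {x}] x, f y = 0) :
    f x = 0 ∧ f' = 0 := by
  have h0 : f x = 0 := by
    by_contra hne
    have ht : Tendsto f (𝓝[s \ {x}] x) (𝓝 (f x)) :=
      hd.continuousWithinAt.mono_left (nhdsWithin_mono _ sdiff_subset)
    exact hf (ht.eventually_ne hne)
  refine ⟨h0, ?_⟩
  by_contra hne
  have ht := (hasDerivWithinAt_iff_tendsto_slope.1 hd).eventually_ne hne
  refine hf (ht.mono fun y hy hy0 => hy ?_)
  simp [slope, hy0, h0]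

theorem im_conj_mul (z z' : ℂ) : ((starRingEnd ℂ) z * z').im = z.re * z'.im - z.im * z'.re := by
  simp only [Complex.mul_im, Complex.conj_re, Complex.conj_im]
  ring

/-- If the imaginary part had no zero, Rolle's theorem for `Re v / Im v` would give a point where
the numerator of the derivative, minus the flux, vanishes. -/
theorem exists_im_eq_zero_of_re_eq_zero {v v' : ℝ → ℂ} {a b : ℝ} (hab : a < b)
    (hd : ∀ x ∈ Icc a b, HasDerivWithinAt v (v' x) (Icc a b) x)
    (hJ : ∀ x ∈ Icc a b, ((starRingEnd ℂ) (v x) * v' x).im ≠ 0)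
    (ha : (v a).re = 0) (hb : (v b).re = 0) : ∃ x ∈ Icc a b, (v x).im = 0 := by
  by_contra! hne
  have hc : ContinuousOn v (Icc a b) := fun x hx => (hd x hx).continuousWithinAt
  have hre : ContinuousOn (fun x => (v x).re) (Icc a b) := Complex.continuous_re.comp_continuousOn hc
  have him : ContinuousOn (fun x => (v x).im) (Icc a b) := Complex.continuous_im.comp_continuousOn hc
  obtain ⟨x, hx, hx0⟩ := exists_hasDerivAt_eq_zero (f := fun x => (v x).re / (v x).im)
    (f' := fun x => ((v' x).re * (v x).im - (v x).re * (v' x).im) / (v x).im ^ 2) hab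
    (hre.div him hne) (by simp [ha, hb]) (fun x hx => by
      have hx' := Ioo_subset_Icc_self hx
      have h1 : HasDerivAt v (v' x) x := (hd x hx').hasDerivAt (Icc_mem_nhds hx.1 hx.2)
      have h2 : HasDerivAt (fun x => (v x).re) (v' x).re x :=
        Complex.reCLM.hasFDerivAt.comp_hasDerivAt x h1
      have h3 : HasDerivAt (fun x => (v x).im) (v' x).im x :=
        Complex.imCLM.hasFDerivAt.comp_hasDerivAt x h1
      exact h2.div h3 (hne x hx'))
  have hx' := Ioo_subset_Icc_self hx
  refine hJ x hx' ?_
  rw [div_eq_zero_iff] at hx0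
  rcases hx0 with h | h
  · rw [im_conj_mul]; linarith
  · exact absurd (pow_eq_zero_iff two_ne_zero |>.1 h) (hne x hx')

/-- At an accumulation point of zeros both `Re v` and `Re v'` vanish, hence so does the flux. Only
the left endpoint permits this, and there interlacing is used. -/
theorem finite_re_eq_zero {v v' : ℝ → ℂ} {a b : ℝ}
    (hd : ∀ x ∈ Icc a b, HasDerivWithinAt v (v' x) (Icc a b) x)
    (hJ : ∀ x ∈ Ioc a b, ((starRingEnd ℂ) (v x) * v' x).im ≠ 0)
    (ha : ¬(v a = 0 ∧ v' a = 0)) : {x ∈ Icc a b | (v x).re = 0}.Finite := by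
  by_contra hinf
  obtain ⟨x, hx, hacc⟩ := Set.Infinite.exists_accPt_of_subset_isCompact hinf isCompact_Icc
    (fun y hy => hy.1)
  have hre (x) (hx : x ∈ Icc a b) :
      HasDerivWithinAt (fun x => (v x).re) (v' x).re (Icc a b) x :=
    Complex.reCLM.hasFDerivAt.comp_hasDerivWithinAt x (hd x hx)
  have him (x) (hx : x ∈ Icc a b) :
      HasDerivWithinAt (fun x => (v x).im) (v' x).im (Icc a b) x :=
    Complex.imCLM.hasFDerivAt.comp_hasDerivWithinAt x (hd x hx)
  have hfr : ∃ᶠ y in 𝓝[Icc a b \ {x}] x, (v y).re = 0 := by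
    rw [accPt_iff_frequently] at hacc
    rw [frequently_nhdsWithin_iff]
    exact hacc.mono fun y hy => ⟨hy.2.2, hy.2.1, hy.1⟩
  obtain ⟨h0, h0'⟩ := eq_zero_of_frequently_eq_zero (hre x hx) hfr
  rcases hx.1.eq_or_lt with rfl | hax
  · have hex : ∀ ε > a, ∃ y ∈ Ioc a b, y < ε ∧ (v y).re = 0 := by
      intro ε hε
      have : ∀ᶠ y in 𝓝[Icc a b \ {a}] a, y < ε := mem_nhdsWithin_of_mem_nhds (Iio_mem_nhds hε)
      obtain ⟨y, hy0, hy1, hy2, hy3⟩ :=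
        (hfr.and_eventually (this.and self_mem_nhdsWithin)).exists
      exact ⟨y, ⟨lt_of_le_of_ne hy2.1 (Ne.symm hy3), hy2.2⟩, hy1, hy0⟩
    -- Between two zeros of `Re v` to the right of `a` lies one of `Im v`; so both parts accumulate
    -- zeros at `a`, forcing zero Cauchy data.
    have hfi : ∃ᶠ y in 𝓝[Icc a b \ {a}] a, (v y).im = 0 := by
      rw [frequently_iff]
      intro U hU
      obtain ⟨ε, hε, hεU⟩ := Metric.mem_nhdsWithin_iff.1 hU
      obtain ⟨y₁, hy₁, hy₁ε, h₁⟩ := hex (a + ε) (by linarith)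
      obtain ⟨y₂, hy₂, hy₂₁, h₂⟩ := hex y₁ hy₁.1
      have hsub : Icc y₂ y₁ ⊆ Icc a b := Icc_subset_Icc hy₂.1.le hy₁.2
      obtain ⟨z, hz, hz0⟩ := exists_im_eq_zero_of_re_eq_zero hy₂₁
        (fun x hx => (hd x (hsub hx)).mono hsub)
        (fun x hx => hJ x ⟨hy₂.1.trans_le hx.1, hx.2.trans hy₁.2⟩) h₂ h₁
      refine ⟨z, hεU ⟨?_, hsub hz, ?_⟩, hz0⟩
      · rw [Metric.mem_ball, Real.dist_eq, abs_lt]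
        constructor <;> linarith [hz.1, hz.2, hy₂.1]
      · exact (hy₂.1.trans_le hz.1).ne'
    obtain ⟨h1, h1'⟩ := eq_zero_of_frequently_eq_zero (him a hx) hfi
    exact ha ⟨Complex.ext h0 h1, Complex.ext h0' h1'⟩
  · refine hJ x ⟨hax, hx.2⟩ ?_
    rw [im_conj_mul, h0, h0']
    ring

/-! ### Modes of symmetric indices -/

theorem intervalIntegrable_sq_mul_norm_sq {L : ℝ} {ω : ℂ} {n : ℝ → ℝ} {u w : ℝ → ℂ}
    (hq : MemLp (sqIndex n) ⊤ volume) (hm : IsMode L ω (sqIndex n) u w) {a b : ℝ}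
    (ha : a ∈ Icc 0 L) (hb : b ∈ Icc 0 L) :
    IntervalIntegrable (fun y => n y ^ 2 * ‖u y‖ ^ 2) volume a b := by
  have hc : ContinuousOn (fun y => ((‖u y‖ ^ 2 : ℝ) : ℂ)) (uIcc a b) := by
    have := (hm.sol.fst.continuousOn.mono (uIcc_subset_Icc ha hb)).norm.pow 2
    exact Complex.continuous_ofReal.comp_continuousOn this
  have h := (intervalIntegrable_of_memLp_top hq a b).mul_continuousOn hc
  have h2 : IntervalIntegrable (fun y => (sqIndex n y * ((‖u y‖ ^ 2 : ℝ) : ℂ)).re) volume a b :=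
    ⟨h.1.re, h.2.re⟩
  refine h2.congr fun y _ => ?_
  simp only [sqIndex]
  norm_cast

namespace IsMode

variable {L : ℝ} {ω : ℂ} {n : ℝ → ℝ} {u w : ℝ → ℂ}

/-- The derivative of `ū u'` is `|u'|² - ω² n² |u|²`, whose first term is real. -/
theorem flux_sub (hm : IsMode L ω (sqIndex n) u w) {a b : ℝ}
    (ha : a ∈ Icc 0 L) (hb : b ∈ Icc 0 L) :
    ((starRingEnd ℂ) (u b) * w b).im - ((starRingEnd ℂ) (u a) * w a).im =
      -(ω ^ 2).im * ∫ y in a..b, n y ^ 2 * ‖u y‖ ^ 2 := by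
  have hp := hm.sol.fst.conj.mul hm.sol.snd
  have h1 := congrArg Complex.im (hp.sub_eq ha hb)
  rw [Complex.sub_im] at h1
  have h2 := intervalIntegral.intervalIntegral_im (hp.intervalIntegrable ha hb)
  rw [h1, ← intervalIntegral.integral_const_mul]
  refine h2.symm.trans (intervalIntegral.integral_congr fun y _ => ?_)
  have e : (starRingEnd ℂ) (w y) * w y + (starRingEnd ℂ) (u y) * (-ω ^ 2 * (sqIndex n y * u y)) =
      ((‖w y‖ ^ 2 : ℝ) : ℂ) - ((n y ^ 2 * ‖u y‖ ^ 2 : ℝ) : ℂ) * ω ^ 2 := by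
    have e1 := Complex.conj_mul' (w y)
    have e2 := Complex.conj_mul' (u y)
    simp only [sqIndex]
    push_cast
    linear_combination e1 - (n y : ℂ) ^ 2 * ω ^ 2 * e2
  simp only [e]
  change Complex.im (_ - _) = _
  rw [Complex.sub_im, Complex.ofReal_im, Complex.im_ofReal_mul]
  ring

theorem cauchy_ne_zero (hq : MemLp (sqIndex n) ⊤ volume) (hm : IsMode L ω (sqIndex n) u w) {x : ℝ}
    (hx : x ∈ Icc 0 L) : ¬(u x = 0 ∧ w x = 0) := fun h => by
  have := (hm.sol.initial_eq_zero hq hx h.1 h.2).1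
  rw [hm.one] at this
  exact one_ne_zero this

theorem hasDerivWithinAt (hm : IsMode L ω (sqIndex n) u w) {x : ℝ} (hx : x ∈ Icc 0 L) :
    HasDerivWithinAt u (w x) (Icc 0 L) x :=
  hm.sol.fst.hasDerivWithinAt hm.sol.snd.continuousOn hx

theorem exists_ne_zero (hq : MemLp (sqIndex n) ⊤ volume) (hm : IsMode L ω (sqIndex n) u w)
    {a b : ℝ} (ha : 0 ≤ a) (hab : a < b) (hb : b ≤ L) : ∃ x ∈ Icc a b, u x ≠ 0 := by
  by_contra! h
  have hc : (a + b) / 2 ∈ Ioo a b := ⟨by linarith, by linarith⟩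
  have hcL : (a + b) / 2 ∈ Ioo 0 L := ⟨by linarith, by linarith⟩
  refine hm.cauchy_ne_zero hq (Ioo_subset_Icc_self hcL) ⟨h _ (Ioo_subset_Icc_self hc), ?_⟩
  have h1 := (hm.hasDerivWithinAt (Ioo_subset_Icc_self hcL)).hasDerivAt
    (Icc_mem_nhds hcL.1 hcL.2)
  refine (h1.congr_of_eventuallyEq ?_).unique (hasDerivAt_const _ (0 : ℂ))
  filter_upwards [Icc_mem_nhds hc.1 hc.2] with y hy using (h y hy).symm

theorem integral_sq_mul_norm_sq_pos (hq : MemLp (sqIndex n) ⊤ volume)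
    (hm : IsMode L ω (sqIndex n) u w) {ν : ℝ} (hν : 0 < ν)
    (hn : ∀ᵐ x, x ∈ Icc 0 L → ν ≤ n x) {a b : ℝ} (ha : 0 ≤ a) (hab : a < b) (hb : b ≤ L) :
    0 < ∫ y in a..b, n y ^ 2 * ‖u y‖ ^ 2 := by
  obtain ⟨c, hc, hc0⟩ := hm.exists_ne_zero hq ha hab hb
  have haI : a ∈ Icc 0 L := ⟨ha, hab.le.trans hb⟩
  have hbI : b ∈ Icc 0 L := ⟨ha.trans hab.le, hb⟩
  have hcont : ContinuousOn (fun y => ν ^ 2 * ‖u y‖ ^ 2) (Icc a b) :=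
    continuousOn_const.mul ((hm.sol.fst.continuousOn.mono (Icc_subset_Icc ha hb)).norm.pow 2)
  have h1 : 0 < ∫ y in a..b, ν ^ 2 * ‖u y‖ ^ 2 := by
    refine intervalIntegral.integral_pos hab hcont (fun y _ => by positivity) ⟨c, hc, ?_⟩
    have := norm_pos_iff.2 hc0
    positivity
  refine h1.trans_le (intervalIntegral.integral_mono_ae_restrict hab.le
    (ContinuousOn.intervalIntegrable_of_Icc hab.le hcont)
    (intervalIntegrable_sq_mul_norm_sq hq hm haI hbI) ?_)
  refine (ae_restrict_iff' measurableSet_Icc).2 ?_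
  filter_upwards [hn] with y hy hyI
  have := hy ⟨ha.trans hyI.1, hyI.2.trans hb⟩
  gcongr

/-- The outgoing conditions make the flux `Re ω |u(L)|²` at `L` and `-Re ω` at `0`. Dividing the
balance by `Re ω` gives `|u(L)|² + 1 = -2 Im ω ∫ n² |u|²`. -/
theorem im_neg (hL : 0 < L) (hq : MemLp (sqIndex n) ⊤ volume) (hm : IsMode L ω (sqIndex n) u w)
    {ν : ℝ} (hν : 0 < ν) (hn : ∀ᵐ x, x ∈ Icc 0 L → ν ≤ n x) (hre : ω.re ≠ 0) : ω.im < 0 := by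
  have h1 := hm.flux_sub ⟨le_rfl, hL.le⟩ ⟨hL.le, le_rfl⟩
  have h2 := hm.integral_sq_mul_norm_sq_pos hq hν hn le_rfl hL le_rfl
  set Q := ∫ y in (0 : ℝ)..L, n y ^ 2 * ‖u y‖ ^ 2
  rw [hm.left, hm.right, hm.one, im_conj_mul, im_conj_mul] at h1
  simp only [Complex.mul_re, Complex.mul_im, Complex.I_re, Complex.I_im, Complex.neg_re,
    Complex.neg_im, Complex.one_re, Complex.one_im, pow_two] at h1
  have h3 : ω.re * ((u L).re ^ 2 + (u L).im ^ 2 + 1 + 2 * ω.im * Q) = 0 := by linear_combination h1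
  have h4 := (mul_eq_zero.1 h3).resolve_left hre
  by_contra! h5
  have : 0 ≤ 2 * ω.im * Q := by positivity
  nlinarith [sq_nonneg (u L).re, sq_nonneg (u L).im]

/-- The reflected mode solves the same equation and is outgoing at `0`, so it is the multiple of `u`
fixed by its value there. -/
theorem reflect_eq (hq : MemLp (sqIndex n) ⊤ volume)
    (hm : IsMode L ω (sqIndex n) u w) (hs : ∀ᵐ x, n x = n (L - x)) {x : ℝ} (hx : x ∈ Icc 0 L) :
    u (L - x) = u L * u x ∧ -w (L - x) = u L * w x := by
  refine (hm.sol.reflect ?_).unique (hm.sol.const_mul (u L)) hq ?_ ?_ hx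
  · filter_upwards [hs] with y hy
    rw [sqIndex, sqIndex, ← hy]
  · simp [hm.one]
  · simp only [sub_zero, hm.left, hm.right]
    ring

theorem sq_right_eq_one (hL : 0 ≤ L) (hq : MemLp (sqIndex n) ⊤ volume)
    (hm : IsMode L ω (sqIndex n) u w) (hs : ∀ᵐ x, n x = n (L - x)) : u L ^ 2 = 1 := by
  have := (hm.reflect_eq hq hs ⟨hL, le_rfl⟩).1
  rw [sub_self, hm.one] at this
  rw [pow_two, ← this]

theorem sq_reflect (hL : 0 ≤ L) (hq : MemLp (sqIndex n) ⊤ volume)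
    (hm : IsMode L ω (sqIndex n) u w) (hs : ∀ᵐ x, n x = n (L - x)) {x : ℝ} (hx : x ∈ Icc 0 L) :
    u (L - x) ^ 2 = u x ^ 2 := by
  rw [(hm.reflect_eq hq hs hx).1, mul_pow, hm.sq_right_eq_one hL hq hs, one_mul]

/-- Even modes have `u'(L/2) = 0` and odd ones `u(L/2) = 0`, so the flux vanishes at the centre;
beyond it the flux is a nonzero multiple of a positive integral. -/
theorem flux_ne_zero (hL : 0 < L) (hq : MemLp (sqIndex n) ⊤ volume)
    (hm : IsMode L ω (sqIndex n) u w) {ν : ℝ} (hν : 0 < ν) (hn : ∀ᵐ x, x ∈ Icc 0 L → ν ≤ n x)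
    (hs : ∀ᵐ x, n x = n (L - x)) (hre : ω.re ≠ 0) {x : ℝ} (hx : x ∈ Ioc (L / 2) L) :
    ((starRingEnd ℂ) (u x) * w x).im ≠ 0 := by
  have hmid : L / 2 ∈ Icc 0 L := ⟨by linarith, by linarith⟩
  have h0 : (starRingEnd ℂ) (u (L / 2)) * w (L / 2) = 0 := by
    obtain ⟨h1, h2⟩ := hm.reflect_eq hq hs hmid
    rw [sub_half] at h1 h2
    rcases sq_eq_one_iff.1 (hm.sq_right_eq_one hL.le hq hs) with h | h
    · rw [h, one_mul] at h2
      have : w (L / 2) = 0 := by linear_combination (-1 / 2 : ℂ) * h2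
      rw [this, mul_zero]
    · rw [h] at h1
      have : u (L / 2) = 0 := by linear_combination (1 / 2 : ℂ) * h1
      rw [this, map_zero, zero_mul]
  have h1 := hm.flux_sub hmid ⟨by linarith [hx.1], hx.2⟩
  rw [h0, Complex.zero_im, sub_zero] at h1
  rw [h1]
  refine mul_ne_zero (neg_ne_zero.2 ?_)
    (hm.integral_sq_mul_norm_sq_pos hq hν hn hmid.1 hx.1 hx.2).ne'
  have := (hm.im_neg hL hq hν hn hre).ne
  rw [pow_two, Complex.mul_im]
  have : ω.re * ω.im ≠ 0 := mul_ne_zero hre this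
  intro h
  exact this (by linarith)

theorem finite_re_const_mul_eq_zero (hL : 0 < L) (hq : MemLp (sqIndex n) ⊤ volume)
    (hm : IsMode L ω (sqIndex n) u w) {ν : ℝ} (hν : 0 < ν) (hn : ∀ᵐ x, x ∈ Icc 0 L → ν ≤ n x)
    (hs : ∀ᵐ x, n x = n (L - x)) (hre : ω.re ≠ 0) {c : ℂ} (hc : c ≠ 0) :
    {x ∈ Icc (L / 2) L | (c * u x).re = 0}.Finite := by
  have hsub : Icc (L / 2) L ⊆ Icc 0 L := Icc_subset_Icc (by linarith) le_rfl
  refine finite_re_eq_zero (v' := fun x => c * w x)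
    (fun x hx => ((hm.hasDerivWithinAt (hsub hx)).mono hsub).const_mul c) (fun x hx => ?_) ?_
  · have h := hm.flux_ne_zero hL hq hν hn hs hre hx
    -- Multiplying the mode by `c` multiplies the flux by `|c|²`.
    have e : (starRingEnd ℂ) (c * u x) * (c * w x) =
        ((‖c‖ ^ 2 : ℝ) : ℂ) * ((starRingEnd ℂ) (u x) * w x) := by
      rw [map_mul]
      push_cast
      linear_combination (starRingEnd ℂ) (u x) * w x * Complex.conj_mul' c
    rw [e, Complex.im_ofReal_mul]
    exact mul_ne_zero (by simpa using hc) h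
  · have := hm.cauchy_ne_zero hq (hsub (left_mem_Icc.2 (by linarith)))
    simpa [hc] using this

/-- The function `Im (C u²)` has finitely many zeros. -/
theorem finite_im_sq_eq_zero (hL : 0 < L) (hq : MemLp (sqIndex n) ⊤ volume)
    (hm : IsMode L ω (sqIndex n) u w) {ν : ℝ} (hν : 0 < ν) (hn : ∀ᵐ x, x ∈ Icc 0 L → ν ≤ n x)
    (hs : ∀ᵐ x, n x = n (L - x)) (hre : ω.re ≠ 0) {C : ℂ} (hC : C ≠ 0) :
    {x ∈ Icc 0 L | (C * u x ^ 2).im = 0}.Finite := by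
  -- With `C = c²`, `Im (C u²) = 2 Re (c u) Im (c u)`; the factor `I` below turns the imaginary part
  -- into a real part.
  obtain ⟨c, hc⟩ := IsAlgClosed.exists_pow_nat_eq C two_pos
  have hc0 : c ≠ 0 := by
    rintro rfl
    exact hC (by rw [← hc]; simp)
  have h1 := hm.finite_re_const_mul_eq_zero hL hq hν hn hs hre hc0
  have h2 := hm.finite_re_const_mul_eq_zero hL hq hν hn hs hre
    (mul_ne_zero Complex.I_ne_zero hc0)
  have hz (x : ℝ) (hx : (C * u x ^ 2).im = 0) :
      (c * u x).re = 0 ∨ (Complex.I * c * u x).re = 0 := by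
    rw [← hc, ← mul_pow, pow_two, Complex.mul_im] at hx
    rw [mul_assoc, Complex.I_mul_re, neg_eq_zero, ← mul_eq_zero]
    linarith
  have h3 := h1.union h2
  -- Zeros in the left half are mirror images, since `u²` is symmetric.
  refine (h3.union (h3.image fun x => L - x)).subset fun x hx => ?_
  rcases le_total (L / 2) x with h | h
  · left
    rcases hz x hx.2 with h' | h'
    · exact Or.inl ⟨⟨h, hx.1.2⟩, h'⟩
    · exact Or.inr ⟨⟨h, hx.1.2⟩, h'⟩
  · right
    have hx2 := hx.2
    rw [← hm.sq_reflect hL.le hq hs hx.1] at hx2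
    have hI : L - x ∈ Icc (L / 2) L := ⟨by linarith, by linarith [hx.1.1]⟩
    refine ⟨L - x, ?_, by simp⟩
    rcases hz _ hx2 with h' | h'
    · exact Or.inl ⟨hI, h'⟩
    · exact Or.inr ⟨hI, h'⟩

end IsMode

/-! ### Splitting of zeros under perturbation -/

/-- The principal root works: its argument `arg z / k` stays in `(0, π)`. -/
theorem exists_pow_eq_im_pos {z : ℂ} (hz : 0 < z.im) {k : ℕ} (hk : k ≠ 0) :
    ∃ s : ℂ, s ^ k = z ∧ 0 < s.im := by
  have hz0 : z ≠ 0 := by rintro rfl; simp at hz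
  have hk0 : (k : ℂ) ≠ 0 := Nat.cast_ne_zero.2 hk
  refine ⟨Complex.exp (Complex.log z / k), ?_, ?_⟩
  · rw [← Complex.exp_nat_mul, mul_div_cancel₀ _ hk0, Complex.exp_log hz0]
  · rw [Complex.exp_im]
    have h1 : (Complex.log z / k).im = z.arg / k := by
      rw [Complex.div_natCast_im, Complex.log_im]
    rw [h1]
    have h0 : 0 < z.arg := by
      refine lt_of_le_of_ne (Complex.arg_nonneg_iff.2 hz.le) fun h => ?_
      exact hz.ne' (Complex.arg_eq_zero_iff.1 h.symm).2
    have hpi : z.arg < Real.pi := lt_of_le_of_ne (Complex.arg_le_pi z) fun h => by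
      have := (Complex.arg_eq_pi_iff.1 h).2
      exact hz.ne' this
    have hk1 : (1 : ℝ) ≤ k := by exact_mod_cast Nat.one_le_iff_ne_zero.2 hk
    refine mul_pos (Real.exp_pos _) (Real.sin_pos_of_pos_of_lt_pi (by positivity) ?_)
    exact (div_le_self h0.le hk1).trans_lt hpi

/-- A weak form of Rouché's theorem: without zeros, `1/G` obeys the maximum principle, but `|G| ≥
2m/3` on the circle and `|G| ≤ m/3` at the centre. -/
theorem exists_zero_of_norm_sub_le {G P : ℂ → ℂ} {s₀ : ℂ} {r m : ℝ} (hr : 0 < r) (hm : 0 < m)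
    (hG : Differentiable ℂ G) (hP : ∀ z ∈ Metric.sphere s₀ r, m ≤ ‖P z‖) (hP0 : P s₀ = 0)
    (hGP : ∀ z ∈ Metric.closedBall s₀ r, ‖G z - P z‖ ≤ m / 3) :
    ∃ z ∈ Metric.closedBall s₀ r, G z = 0 := by
  by_contra! hne
  have hd : DiffContOnCl ℂ (fun z => (G z)⁻¹) (Metric.ball s₀ r) :=
    hG.diffContOnCl.inv (by rwa [closure_ball s₀ hr.ne'])
  have hb : ∀ z ∈ frontier (Metric.ball s₀ r), ‖(G z)⁻¹‖ ≤ (2 * m / 3)⁻¹ := by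
    intro z hz
    rw [frontier_ball s₀ hr.ne'] at hz
    rw [norm_inv]
    refine inv_anti₀ (by positivity) ?_
    have h1 := hGP z (Metric.sphere_subset_closedBall hz)
    have h2 := hP z hz
    have h3 := norm_sub_norm_le (P z) (G z)
    rw [norm_sub_rev] at h3
    linarith
  have h := Complex.norm_le_of_forall_mem_frontier_norm_le Metric.isBounded_ball hd hb
    (subset_closure (Metric.mem_ball_self hr))
  have h1 := hGP s₀ (Metric.mem_closedBall_self hr.le)
  rw [hP0, sub_zero] at h1
  rw [norm_inv] at h
  have h0 : 0 < ‖G s₀‖ := norm_pos_iff.2 (hne s₀ (Metric.mem_closedBall_self hr.le))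
  have := (inv_le_inv₀ h0 (by positivity)).1 h
  linarith

/-- The derivative of `sᵏ` at `s₀` is nonzero, so `s₀` is an isolated root; compactness of the
circle gives `m`. -/
theorem exists_radius_pow_ne {B s₀ : ℂ} {k : ℕ} (hk : k ≠ 0) (hB : B ≠ 0) (hs : 0 < s₀.im) :
    ∃ r m : ℝ, 0 < r ∧ 0 < m ∧ (∀ s ∈ Metric.closedBall s₀ r, 0 < s.im) ∧
      ∀ s ∈ Metric.sphere s₀ r, m ≤ ‖B * (s ^ k - s₀ ^ k)‖ := by
  have hs0 : s₀ ≠ 0 := by rintro rfl; simp at hs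
  have hd : HasDerivAt (fun s : ℂ => s ^ k) (k * s₀ ^ (k - 1)) s₀ := hasDerivAt_pow k s₀
  have hne := hd.eventually_ne (c := s₀ ^ k) (mul_ne_zero (Nat.cast_ne_zero.2 hk) (pow_ne_zero _ hs0))
  rw [eventually_nhdsWithin_iff] at hne
  have him : ∀ᶠ s : ℂ in 𝓝 s₀, 0 < s.im :=
    Complex.continuous_im.continuousAt.eventually (lt_mem_nhds hs)
  obtain ⟨r, hr, hrs⟩ := Metric.nhds_basis_closedBall.mem_iff.1 (hne.and him)
  have hcont : Continuous fun s : ℂ => ‖B * (s ^ k - s₀ ^ k)‖ := by fun_prop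
  have hcpt := isCompact_sphere s₀ r
  have hnon : (Metric.sphere s₀ r).Nonempty := NormedSpace.sphere_nonempty.2 hr.le
  obtain ⟨z, hz, hzm⟩ := hcpt.exists_isMinOn hnon hcont.continuousOn
  refine ⟨r, _, hr, ?_, fun s hs' => (hrs hs').2, fun s hs' => hzm hs'⟩
  have h1 := (hrs (Metric.sphere_subset_closedBall hz)).1
    (Metric.ne_of_mem_sphere hz hr.ne')
  exact norm_pos_iff.2 (mul_ne_zero hB (sub_ne_zero.2 h1))

/-- Let `F(·, 0)` have the leading term `B (z - ω₀)ᵏ` at `ω₀` and put `A = ∂ₜF(ω₀, 0)`. If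
`Im (-A / B) > 0`, then for suitable small `t > 0` the function `F(·, t)` has a zero near `ω₀` with
imaginary part larger than that of `ω₀`. -/
theorem exists_zero_im_lt {F : ℂ × ℂ → ℂ} (hF : ContDiff ℂ 1 F) {ω₀ A B : ℂ} {g : ℂ → ℂ} {k : ℕ}
    (hk : k ≠ 0) (hg : ContinuousAt g ω₀) (hgB : g ω₀ = B) (hB : B ≠ 0)
    (hFg : ∀ᶠ z in 𝓝 ω₀, F (z, 0) = (z - ω₀) ^ k * g z)
    (hA : HasDerivAt (fun t => F (ω₀, t)) A 0) (him : 0 < (-A / B).im) {ε : ℝ} (hε : 0 < ε) :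
    ∃ t : ℝ, 0 < t ∧ t < ε ∧ ∃ ω : ℂ, ‖ω - ω₀‖ < ε ∧ ω₀.im < ω.im ∧ F (ω, t) = 0 := by
  -- Puiseux scaling: with `t = τᵏ` and `ω = ω₀ + τ s`, the quotient `F / τᵏ` tends to `B sᵏ + A = B
  -- (sᵏ - s₀ᵏ)`, so zeros near `s₀` persist for small `τ`.
  obtain ⟨s₀, hs₀, hs₀im⟩ := exists_pow_eq_im_pos him hk
  obtain ⟨r, m, hr, hm, hball, hsph⟩ := exists_radius_pow_ne hk hB hs₀im
  set R : ℝ := ‖s₀‖ + r + 1 with hR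
  have hR1 : 1 ≤ R := by have := norm_nonneg s₀; linarith
  have hR0 : 0 < R := by linarith
  have hsR : ∀ s ∈ Metric.closedBall s₀ r, ‖s‖ ≤ R := by
    intro s hs
    have h1 := norm_sub_norm_le s s₀
    rw [Metric.mem_closedBall, dist_eq_norm] at hs
    linarith
  have hstrict : HasStrictFDerivAt F (fderiv ℂ F (ω₀, 0)) (ω₀, 0) :=
    hF.contDiffAt.hasStrictFDerivAt one_ne_zero
  have hAeq : fderiv ℂ F (ω₀, 0) (0, 1) = A := by
    have h1 : HasDerivAt (fun t : ℂ => (ω₀, t)) ((0 : ℂ), (1 : ℂ)) 0 :=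
      (hasDerivAt_const _ _).prodMk (hasDerivAt_id _)
    exact (hstrict.hasFDerivAt.comp_hasDerivAt (0 : ℂ) h1).unique hA
  have hlin := hstrict.isLittleO.def (c := m / 6) (by positivity)
  have hcont : Tendsto (fun p : ℂ × ℂ => (p, (p.1, (0 : ℂ)))) (𝓝 (ω₀, 0))
      (𝓝 ((ω₀, 0), (ω₀, 0))) :=
    Continuous.tendsto' (by fun_prop) _ _ rfl
  have hlin2 : ∀ᶠ p : ℂ × ℂ in 𝓝 (ω₀, 0),
      ‖F p - F (p.1, 0) - A * p.2‖ ≤ m / 6 * ‖p.2‖ := by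
    filter_upwards [hcont.eventually hlin] with p hp
    have e : p - (p.1, (0 : ℂ)) = p.2 • ((0 : ℂ), (1 : ℂ)) := by
      ext <;> simp
    simp only [e, map_smul, hAeq, norm_smul, smul_eq_mul] at hp
    simpa [mul_comm] using hp
  have hg2 : ∀ᶠ z in 𝓝 ω₀, ‖g z - B‖ ≤ m / 6 / R ^ k := by
    have := hg.eventually (Metric.closedBall_mem_nhds (g ω₀) (ε := m / 6 / R ^ k) (by positivity))
    filter_upwards [this] with z hz
    rwa [← hgB, ← dist_eq_norm]
  have hall : ∀ᶠ p : ℂ × ℂ in 𝓝 (ω₀, 0), ‖F p - F (p.1, 0) - A * p.2‖ ≤ m / 6 * ‖p.2‖ ∧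
      ‖g p.1 - B‖ ≤ m / 6 / R ^ k ∧ F (p.1, 0) = (p.1 - ω₀) ^ k * g p.1 :=
    hlin2.and ((continuous_fst.tendsto (ω₀, (0 : ℂ))).eventually (hg2.and hFg))
  obtain ⟨δ, hδ, hδp⟩ := Metric.eventually_nhds_iff_ball.1 hall
  set η : ℝ := min 1 (min δ ε) with hη
  have hη0 : 0 < η := by positivity
  -- This makes both displacements `τ |s| ≤ τ R` and `τᵏ ≤ τ` smaller than `η`.
  set τ : ℝ := η / (2 * R) with hτ
  have hτ0 : 0 < τ := by positivity
  have hτR : τ * R < η := by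
    rw [hτ]
    field_simp
    linarith
  have hτη : τ < η := lt_of_le_of_lt (by nlinarith) hτR
  have hτ1 : τ < 1 := hτη.trans_le (min_le_left _ _)
  have hτk : τ ^ k ≤ τ := by
    simpa using pow_le_pow_of_le_one hτ0.le hτ1.le (Nat.one_le_iff_ne_zero.2 hk)
  have hτk0 : 0 < τ ^ k := by positivity
  have hτc : ((τ : ℂ)) ^ k ≠ 0 := pow_ne_zero _ (Complex.ofReal_ne_zero.2 hτ0.ne')
  have hnear : ∀ s ∈ Metric.closedBall s₀ r, ‖(τ : ℂ) * s‖ < η := by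
    intro s hs
    rw [norm_mul, Complex.norm_real, Real.norm_of_nonneg hτ0.le]
    exact (mul_le_mul_of_nonneg_left (hsR s hs) hτ0.le).trans_lt hτR
  have hGd : Differentiable ℂ fun s => F (ω₀ + τ * s, (τ : ℂ) ^ k) / (τ : ℂ) ^ k := by
    have hFd : Differentiable ℂ F := hF.differentiable one_ne_zero
    have : Differentiable ℂ fun s : ℂ => (ω₀ + τ * s, (τ : ℂ) ^ k) := by fun_prop
    exact (hFd.comp this).div_const _
  have hGP : ∀ s ∈ Metric.closedBall s₀ r,
      ‖F (ω₀ + τ * s, (τ : ℂ) ^ k) / (τ : ℂ) ^ k - B * (s ^ k - s₀ ^ k)‖ ≤ m / 3 := by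
    intro s hs
    have hp := hδp (ω₀ + τ * s, (τ : ℂ) ^ k) (by
      rw [Metric.mem_ball, Prod.dist_eq, max_lt_iff]
      have hηδ : η ≤ δ := (min_le_right _ _).trans (min_le_left _ _)
      constructor
      · simp only [dist_eq_norm, add_sub_cancel_left]
        exact (hnear s hs).trans_le hηδ
      · simp only [dist_zero_right, norm_pow, Complex.norm_real, Real.norm_of_nonneg hτ0.le]
        exact (hτk.trans_lt hτη).trans_le hηδ)
    obtain ⟨h1, h2, h3⟩ := hp
    simp only [add_sub_cancel_left] at h1 h2 h3
    have hBs : B * s₀ ^ k = -A := by rw [hs₀]; field_simp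
    -- The error splits into the nonlinear part in `t` and the variation of `g`, each at most `m /
    -- 6`.
    have e : F (ω₀ + τ * s, (τ : ℂ) ^ k) / (τ : ℂ) ^ k - B * (s ^ k - s₀ ^ k) =
        (F (ω₀ + τ * s, (τ : ℂ) ^ k) - F (ω₀ + τ * s, 0) - A * (τ : ℂ) ^ k) / (τ : ℂ) ^ k +
          s ^ k * (g (ω₀ + τ * s) - B) := by
      rw [h3]
      field_simp
      linear_combination (τ : ℂ) ^ k * hBs
    rw [e]
    have hn : ‖(τ : ℂ) ^ k‖ = τ ^ k := by
      rw [norm_pow, Complex.norm_real, Real.norm_of_nonneg hτ0.le]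
    rw [hn] at h1
    have b1 : ‖(F (ω₀ + τ * s, (τ : ℂ) ^ k) - F (ω₀ + τ * s, 0) - A * (τ : ℂ) ^ k) /
        (τ : ℂ) ^ k‖ ≤ m / 6 := by
      rw [norm_div, hn, div_le_iff₀ hτk0]
      exact h1
    have b2 : ‖s ^ k * (g (ω₀ + τ * s) - B)‖ ≤ m / 6 := by
      rw [norm_mul, norm_pow]
      calc ‖s‖ ^ k * ‖g (ω₀ + τ * s) - B‖ ≤ R ^ k * (m / 6 / R ^ k) := by
            gcongr
            exact hsR s hs
        _ = m / 6 := by field_simp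
    exact (norm_add_le _ _).trans (by linarith)
  obtain ⟨s, hs, hs0⟩ := exists_zero_of_norm_sub_le hr hm hGd hsph (by simp) hGP
  refine ⟨τ ^ k, hτk0, ?_, ω₀ + τ * s, ?_, ?_, ?_⟩
  · exact (hτk.trans_lt hτη).trans_le ((min_le_right _ _).trans (min_le_right _ _))
  · rw [add_sub_cancel_left]
    exact (hnear s hs).trans_le ((min_le_right _ _).trans (min_le_right _ _))
  · rw [Complex.add_im, Complex.im_ofReal_mul]
    have := mul_pos hτ0 (hball s hs)
    linarith
  · rw [Complex.ofReal_pow]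
    exact (div_eq_zero_iff.1 hs0).resolve_right hτc

/-! ### Dependence of the characteristic function on the index -/

/-- Inversion is smooth at units, and the operator is polynomial in the two parameters. -/
theorem contDiff_inverse_apply {E : Type*} [NormedAddCommGroup E] [NormedSpace ℂ E]
    [CompleteSpace E] (J A B : E →L[ℂ] E) (e₀ e₁ : E)
    (hU : ∀ p : ℂ × ℂ, IsUnit (1 + p.1 ^ 2 • (J * (A + p.2 • B)))) :
    ContDiff ℂ 1 fun p : ℂ × ℂ => Ring.inverse (1 + p.1 ^ 2 • (J * (A + p.2 • B)))
      ((1 : ℂ) • e₀ + (-(Complex.I * p.1)) • e₁) := by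
  refine ContDiff.clm_apply ?_ (by fun_prop)
  rw [contDiff_iff_contDiffAt]
  intro p
  obtain ⟨x, hx⟩ := hU p
  have h1 : ContDiffAt ℂ 1 Ring.inverse (1 + p.1 ^ 2 • (J * (A + p.2 • B))) := by
    rw [← hx]
    exact contDiffAt_ringInverse ℂ x
  have h2 : ContDiff ℂ 1 fun p : ℂ × ℂ => 1 + p.1 ^ 2 • (J * (A + p.2 • B)) := by
    refine contDiff_const.add ((contDiff_fst.pow 2).smul (contDiff_const.mul ?_))
    exact contDiff_const.add (contDiff_snd.smul contDiff_const)
  exact ContDiffAt.comp p h1 h2.contDiffAt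

theorem contDiff_apply_inverse_apply {E : Type*} [NormedAddCommGroup E] [NormedSpace ℂ E]
    [CompleteSpace E] (J A B : E →L[ℂ] E) (e₀ e₁ : E) (ℓ : E →L[ℂ] ℂ)
    (hU : ∀ p : ℂ × ℂ, IsUnit (1 + p.1 ^ 2 • (J * (A + p.2 • B)))) :
    ContDiff ℂ 1 fun p : ℂ × ℂ => -(Complex.I * p.1) - p.1 ^ 2 * ℓ ((A + p.2 • B)
      (Ring.inverse (1 + p.1 ^ 2 • (J * (A + p.2 • B)))
        ((1 : ℂ) • e₀ + (-(Complex.I * p.1)) • e₁))) -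
      Complex.I * p.1 * ℓ (Ring.inverse (1 + p.1 ^ 2 • (J * (A + p.2 • B)))
        ((1 : ℂ) • e₀ + (-(Complex.I * p.1)) • e₁)) := by
  have h := contDiff_inverse_apply J A B e₀ e₁ hU
  have hAB : ContDiff ℂ 1 fun p : ℂ × ℂ => A + p.2 • B :=
    contDiff_const.add (contDiff_snd.smul contDiff_const)
  have h1 := ℓ.contDiff.comp (hAB.clm_apply h)
  have h2 := ℓ.contDiff.comp h
  refine (ContDiff.sub (by fun_prop) (ContDiff.mul (by fun_prop) h1)).sub
    (ContDiff.mul (by fun_prop) h2)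

theorem memLp_add_mul {q b : ℝ → ℂ} (hq : MemLp q ⊤ volume) (hb : MemLp b ⊤ volume) (t : ℂ) :
    MemLp (fun x => q x + t * b x) ⊤ volume :=
  hq.add (hb.const_mul t)

variable {L : ℝ} (hL : 0 ≤ L) {q b : ℝ → ℂ} (hq : MemLp q ⊤ volume) (hb : MemLp b ⊤ volume)

theorem volterraTwo_add_mul (t : ℂ) : volterraTwo hL (memLp_add_mul hq hb t) =
    volterra hL memLp_top_one * (volterra hL hq + t • volterra hL hb) := by
  rw [volterraTwo, volterra_add_smul hL hq hb]

theorem isUnit_add_mul (p : ℂ × ℂ) : IsUnit (1 + p.1 ^ 2 •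
    (volterra hL memLp_top_one * (volterra hL hq + p.2 • volterra hL hb))) := by
  rw [← volterraTwo_add_mul]
  exact isUnit_one_add_smul_volterraTwo hL _ _

theorem contDiff_outPath :
    ContDiff ℂ 1 fun p : ℂ × ℂ => outPath hL (memLp_add_mul hq hb p.2) p.1 := by
  have h := contDiff_inverse_apply (volterra hL memLp_top_one) (volterra hL hq) (volterra hL hb)
    1 ⟨fun x => ((x : ℝ) : ℂ), by fun_prop⟩ (isUnit_add_mul hL hq hb)
  simp only [outPath, solPath, volterraTwo, volterra_add_smul hL hq hb]
  exact h

theorem contDiff_charFun :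
    ContDiff ℂ 1 fun p : ℂ × ℂ => charFun hL (memLp_add_mul hq hb p.2) p.1 := by
  have h := contDiff_apply_inverse_apply (volterra hL memLp_top_one) (volterra hL hq)
    (volterra hL hb) 1 ⟨fun x => ((x : ℝ) : ℂ), by fun_prop⟩
    (ContinuousMap.evalCLM ℂ (⟨L, hL, le_rfl⟩ : Icc (0 : ℝ) L)) (isUnit_add_mul hL hq hb)
  simp only [charFun, outPath, solPath, volterraTwo, volterra_add_smul hL hq hb]
  exact h

theorem continuous_outPath (ω : ℂ) :
    Continuous fun t : ℂ => outPath hL (memLp_add_mul hq hb t) ω := by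
  have h := (contDiff_outPath hL hq hb).continuous
  have h2 : Continuous fun t : ℂ => (ω, t) := by fun_prop
  exact (h.comp h2).congr fun t => rfl

/-- The Wronskian of the perturbed outgoing solution with the mode vanishes at `0` and equals the
left-hand side at `L`. The identity is exact in `t`. -/
theorem charFun_add_mul_eq {u w : ℝ → ℂ} {ω : ℂ} (hm : IsMode L ω q u w) (t : ℂ) :
    u L * charFun hL (memLp_add_mul hq hb t) ω =
      t * (-ω ^ 2 * ∫ y in (0 : ℝ)..L, b y *
        (IccExtend hL (outPath hL (memLp_add_mul hq hb t) ω) y * u y)) := by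
  obtain ⟨w', h1, h2, h3⟩ := exists_isSol_outPath hL (memLp_add_mul hq hb t) ω
  have hW := (h1.wronskian hm.sol).eq L ⟨hL, le_rfl⟩
  rw [charFun_eq hL _ h1 h2 h3]
  simp only [h2, h3, hm.one, hm.left, hm.right, add_sub_cancel_left] at hW
  rw [intervalIntegral.integral_const_mul] at hW
  have e : ∫ y in (0 : ℝ)..L, t * b y *
      (IccExtend hL (outPath hL (memLp_add_mul hq hb t) ω) y * u y) =
      t * ∫ y in (0 : ℝ)..L, b y *
        (IccExtend hL (outPath hL (memLp_add_mul hq hb t) ω) y * u y) := by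
    rw [← intervalIntegral.integral_const_mul]
    simp only [mul_assoc]
  rw [e] at hW
  linear_combination hW

/-- The exact identity reads `t H(t)` with `H` continuous, so the derivative is `H(0)`, where the
perturbed solution is the mode itself. -/
theorem hasDerivAt_charFun {u w : ℝ → ℂ} {ω : ℂ} (hm : IsMode L ω q u w) (huL : u L ≠ 0) :
    HasDerivAt (fun t => charFun hL (memLp_add_mul hq hb t) ω)
      (-ω ^ 2 / u L * ∫ y in (0 : ℝ)..L, b y * u y ^ 2) 0 := by
  let v : C(Icc (0 : ℝ) L, ℂ) := ⟨fun x => u x, hm.sol.fst.continuousOn.domRestrict⟩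
  have hv : ∀ y ∈ Icc 0 L, IccExtend hL v y = u y := fun y hy => by
    rw [IccExtend_of_mem hL _ hy]; rfl
  set o : ℂ → C(Icc (0 : ℝ) L, ℂ) := fun t => outPath hL (memLp_add_mul hq hb t) ω with ho
  have hoc : Continuous o := continuous_outPath hL hq hb ω
  set H : ℂ → ℂ := fun t => -ω ^ 2 / u L * volterra hL hb (o t * v) ⟨L, hL, le_rfl⟩ with hH
  have hHc : Continuous H := by
    have : Continuous fun t => volterra hL hb (o t * v) :=
      (volterra hL hb).continuous.comp (hoc.mul continuous_const)
    exact continuous_const.mul ((continuous_eval_const _).comp this)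
  have hFH (t : ℂ) : charFun hL (memLp_add_mul hq hb t) ω = t * H t := by
    have h1 := charFun_add_mul_eq hL hq hb hm t
    have h2 : volterra hL hb (o t * v) ⟨L, hL, le_rfl⟩ = ∫ y in (0 : ℝ)..L, b y *
        (IccExtend hL (outPath hL (memLp_add_mul hq hb t) ω) y * u y) := by
      rw [volterra_apply]
      refine intervalIntegral.integral_congr fun y hy => ?_
      rw [uIcc_of_le hL] at hy
      simp only [← hv y hy]
      rfl
    simp only [hH, h2]
    refine mul_left_cancel₀ huL (h1.trans ?_)
    field_simp
  have hH0 : H 0 = -ω ^ 2 / u L * ∫ y in (0 : ℝ)..L, b y * u y ^ 2 := by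
    simp only [hH, volterra_apply]
    congr 1
    refine intervalIntegral.integral_congr fun y hy => ?_
    rw [uIcc_of_le hL] at hy
    have e0 : IccExtend hL (o 0) y = u y := by
      obtain ⟨w', h1, h2, h3⟩ := exists_isSol_outPath hL (memLp_add_mul hq hb 0) ω
      have h4 : IsSol L (ω ^ 2) q (IccExtend hL (o 0)) w' :=
        ⟨h1.fst, h1.snd.congr fun x _ => by rw [zero_mul, add_zero]⟩
      exact (h4.unique hm.sol hq (h2.trans hm.one.symm) (h3.trans hm.left.symm) hy).1
    have : IccExtend hL (o 0 * v) y = IccExtend hL (o 0) y * IccExtend hL v y := rfl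
    simp only [this, e0, hv y hy]
    ring
  rw [← hH0, hasDerivAt_iff_tendsto_slope]
  refine ((hHc.tendsto 0).mono_left nhdsWithin_le_nhds).congr' ?_
  filter_upwards [self_mem_nhdsWithin] with t ht
  rw [slope_def_field, hFH, hFH]
  have : t ≠ 0 := ht
  field_simp
  simp

theorem charFun_congr {q' : ℝ → ℂ} (hq' : MemLp q' ⊤ volume) (h : q = q') (ω : ℂ) :
    charFun hL hq ω = charFun hL hq' ω := by
  subst h
  rfl

theorem charFun_add_zero (ω : ℂ) : charFun hL (memLp_add_mul hq hb 0) ω = charFun hL hq ω :=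
  charFun_congr hL _ _ (by ext x; simp) ω

theorem differentiable_charFun : Differentiable ℂ (charFun hL hq) := by
  -- The choice of `q` as direction is immaterial: only the slice `t = 0` is used.
  have h := (contDiff_charFun hL hq hq).differentiable one_ne_zero
  have h2 : Differentiable ℂ fun z : ℂ => (z, (0 : ℂ)) := by fun_prop
  have h3 := h.comp h2
  have e : (fun z => charFun hL (memLp_add_mul hq hq 0) z) = charFun hL hq :=
    funext fun z => charFun_add_zero hL hq hq z
  rw [← e]
  exact h3

/-! ### Perturbations of the index -/

/-- The index whose square is `n² + t β`. -/
def perturb (n β : ℝ → ℝ) (t : ℝ) (x : ℝ) : ℝ := Real.sqrt (n x ^ 2 + t * β x)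

/-- `n² + β` is the square of a symmetric admissible index that equals `n²` off `[0, L]`. -/
structure IsDirection (L a b : ℝ) (n β : ℝ → ℝ) : Prop where
  aemeasurable : AEMeasurable β volume
  nonneg : ∀ x, 0 ≤ n x ^ 2 + β x
  bounds : ∀ᵐ x, x ∈ Icc 0 L → a ^ 2 ≤ n x ^ 2 + β x ∧ n x ^ 2 + β x ≤ b ^ 2
  off : ∀ x ∉ Icc 0 L, β x = 0
  symm : ∀ᵐ x, β x = β (L - x)

namespace IsDirection

variable {L a b t : ℝ} {n β : ℝ → ℝ}

theorem perturb_sq (hβ : IsDirection L a b n β) (ht0 : 0 ≤ t) (ht1 : t ≤ 1) (x : ℝ) :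
    perturb n β t x ^ 2 = n x ^ 2 + t * β x := by
  refine Real.sq_sqrt ?_
  -- `n² + tβ` is the convex combination `(1 - t) n² + t (n² + β)`.
  nlinarith [hβ.nonneg x, sq_nonneg (n x)]

theorem perturb_bounds (hβ : IsDirection L a b n β) (ha : 0 < a)
    (hn : n ∈ Admissible L a b) (ht0 : 0 ≤ t) (ht1 : t ≤ 1) :
    ∀ᵐ x, x ∈ Icc 0 L → a ≤ perturb n β t x ∧ perturb n β t x ≤ b := by
  filter_upwards [hn.2.2, hβ.bounds] with x h1 h2 hx
  obtain ⟨h1a, h1b⟩ := h1 hx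
  obtain ⟨h2a, h2b⟩ := h2 hx
  have e1 : a ^ 2 ≤ n x ^ 2 := by gcongr
  have e2 : n x ^ 2 ≤ b ^ 2 := by gcongr; linarith
  refine ⟨Real.le_sqrt_of_sq_le ?_, Real.sqrt_le_iff.2 ⟨by linarith, ?_⟩⟩
  · nlinarith
  · nlinarith

theorem perturb_off (hβ : IsDirection L a b n β) (hn : n ∈ Admissible L a b) :
    ∀ᵐ x, x ∉ Icc 0 L → perturb n β t x = 1 := by
  filter_upwards [hn.2.1] with x h1 hx
  rw [perturb, h1 hx, hβ.off x hx]
  simp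

theorem perturb_mem (hβ : IsDirection L a b n β) (ha : 0 < a)
    (hn : n ∈ AdmissibleSym L a b) (ht0 : 0 ≤ t) (ht1 : t ≤ 1) :
    perturb n β t ∈ AdmissibleSym L a b := by
  refine ⟨⟨?_, hβ.perturb_off hn.1, hβ.perturb_bounds ha hn.1 ht0 ht1⟩, ?_⟩
  · exact ((hn.1.1.pow_const 2).add (hβ.aemeasurable.const_mul t)).sqrt
  · filter_upwards [hn.2, hβ.symm] with x h1 h2
    rw [perturb, perturb, ← h1, ← h2]

/-- On `[0, L]` the difference of squares is `tβ`, while the sum of the two indices is at least `a`.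
-/
theorem eLpNorm_perturb_sub_le (hβ : IsDirection L a b n β) (ha : 0 < a) (hab : a < b)
    (hn : n ∈ Admissible L a b) (ht0 : 0 ≤ t) (ht1 : t ≤ 1) :
    eLpNorm (fun x => perturb n β t x - n x) ⊤ volume ≤
      ENNReal.ofReal (t * (b ^ 2 - a ^ 2) / a) := by
  rw [eLpNorm_exponent_top]
  refine eLpNormEssSup_le_of_ae_bound ?_
  filter_upwards [hn.2.1, hn.2.2, hβ.bounds, hβ.perturb_off hn (t := t),
    hβ.perturb_bounds ha hn ht0 ht1] with x h1 h2 h3 h4 h5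
  by_cases hx : x ∈ Icc 0 L
  · obtain ⟨h2a, h2b⟩ := h2 hx
    obtain ⟨h3a, h3b⟩ := h3 hx
    obtain ⟨h5a, -⟩ := h5 hx
    have e1 : a ^ 2 ≤ n x ^ 2 := by gcongr
    have e2 : n x ^ 2 ≤ b ^ 2 := by gcongr; linarith
    have hs := hβ.perturb_sq ht0 ht1 x
    rw [Real.norm_eq_abs, le_div_iff₀ ha]
    have h6 : |perturb n β t x - n x| * (perturb n β t x + n x) = t * |β x| := by
      rw [← abs_of_nonneg (show 0 ≤ perturb n β t x + n x by linarith), ← abs_mul,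
        ← abs_of_nonneg ht0, ← abs_mul, abs_of_nonneg ht0]
      congr 1
      linear_combination hs
    have h7 : |β x| ≤ b ^ 2 - a ^ 2 := abs_le.2 ⟨by linarith, by linarith⟩
    calc |perturb n β t x - n x| * a ≤ |perturb n β t x - n x| * (perturb n β t x + n x) := by
          gcongr
          linarith
      _ = t * |β x| := h6
      _ ≤ _ := by gcongr
  · rw [h1 hx, h4 hx, sub_self, norm_zero]
    have : a ^ 2 ≤ b ^ 2 := by gcongr
    exact div_nonneg (mul_nonneg ht0 (by linarith)) ha.le

theorem sqIndex_perturb (hβ : IsDirection L a b n β) (ht0 : 0 ≤ t) (ht1 : t ≤ 1) :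
    sqIndex (perturb n β t) = fun x => sqIndex n x + (t : ℂ) * (β x : ℂ) := by
  ext x
  rw [sqIndex, ← Complex.ofReal_pow, hβ.perturb_sq ht0 ht1]
  simp [sqIndex]

theorem memLp (hβ : IsDirection L a b n β) (ha : 0 < a) (hn : n ∈ Admissible L a b) :
    MemLp (fun x => (β x : ℂ)) ⊤ volume := by
  refine memLp_top_of_bound
    (Complex.measurable_ofReal.comp_aemeasurable hβ.aemeasurable).aestronglyMeasurable
    (a ^ 2 + b ^ 2) ?_
  filter_upwards [hn.2.2, hβ.bounds] with x h2 h3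
  rw [Complex.norm_real, Real.norm_eq_abs]
  by_cases hx : x ∈ Icc 0 L
  · obtain ⟨h2a, h2b⟩ := h2 hx
    obtain ⟨h3a, h3b⟩ := h3 hx
    have e1 : a ^ 2 ≤ n x ^ 2 := by gcongr
    have e2 : n x ^ 2 ≤ b ^ 2 := by gcongr; linarith
    exact abs_le.2 ⟨by nlinarith, by nlinarith⟩
  · rw [hβ.off x hx, abs_zero]
    positivity

end IsDirection

/-- The direction from `n²` to the square of the index equal to `b` where `f > 0` and to `a` where
`f < 0`. -/
def bangDir (L a b : ℝ) (f n : ℝ → ℝ) (x : ℝ) : ℝ :=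
  if x ∈ Icc 0 L then
    if 0 < f x then b ^ 2 - n x ^ 2 else if f x < 0 then a ^ 2 - n x ^ 2 else 0
  else 0

theorem isDirection_bangDir {L a b : ℝ} {f n : ℝ → ℝ} (ha : 0 < a)
    (hn : n ∈ AdmissibleSym L a b) (hf : Continuous f) (hfs : ∀ x ∈ Icc 0 L, f (L - x) = f x) :
    IsDirection L a b n (bangDir L a b f n) where
  aemeasurable := by
    have hm1 : MeasurableSet {x | 0 < f x} := measurableSet_lt measurable_const hf.measurable
    have hm2 : MeasurableSet {x | f x < 0} := measurableSet_lt hf.measurable measurable_const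
    have h := hn.1.1.measurable_mk.pow_const 2
    refine ⟨bangDir L a b f (hn.1.1.mk n), ?_, ?_⟩
    · exact Measurable.ite measurableSet_Icc (Measurable.ite hm1 (h.const_sub _)
        (Measurable.ite hm2 (h.const_sub _) measurable_const)) measurable_const
    · filter_upwards [hn.1.1.ae_eq_mk] with x hx
      simp only [bangDir, hx]
  nonneg x := by
    have := sq_nonneg (n x)
    unfold bangDir
    split_ifs <;> nlinarith [sq_nonneg a, sq_nonneg b]
  bounds := by
    filter_upwards [hn.1.2.2] with x h hx
    obtain ⟨h1, h2⟩ := h hx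
    have e1 : a ^ 2 ≤ n x ^ 2 := by gcongr
    have e2 : n x ^ 2 ≤ b ^ 2 := by gcongr; linarith
    unfold bangDir
    rw [if_pos hx]
    split_ifs <;> constructor <;> linarith
  off x hx := if_neg hx
  symm := by
    filter_upwards [hn.2] with x h
    unfold bangDir
    have hiff : L - x ∈ Icc 0 L ↔ x ∈ Icc 0 L := by
      simp only [mem_Icc]
      constructor <;> rintro ⟨h1, h2⟩ <;> constructor <;> linarith
    by_cases hx : x ∈ Icc 0 L
    · rw [if_pos hx, if_pos (hiff.2 hx), hfs x hx, ← h]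
    · rw [if_neg hx, if_neg (fun h => hx (hiff.1 h))]

theorem bangDir_mul_nonneg {L a b : ℝ} {f n : ℝ → ℝ} (ha : 0 < a) {x : ℝ}
    (h1 : a ≤ n x) (h2 : n x ≤ b) : 0 ≤ bangDir L a b f n x * f x := by
  have e1 : a ^ 2 ≤ n x ^ 2 := by gcongr
  have e2 : n x ^ 2 ≤ b ^ 2 := by gcongr; linarith
  unfold bangDir
  split_ifs with hx hp hm
  · exact mul_nonneg (by linarith) hp.le
  · exact mul_nonneg_of_nonpos_of_nonpos (by linarith) hm.le
  · simp
  · simp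

/-! ### Bang-bang indices with finitely many switches -/

/-- Where `f ≠ 0` its sign is locally constant, so nearby one of the two values occurs only on a
null set: transitions happen at zeros of `f`. -/
theorem finite_transition {L a b : ℝ} {f n : ℝ → ℝ} (hab : a < b) (hf : Continuous f)
    (hfin : {x ∈ Icc 0 L | f x = 0}.Finite)
    (hp : ∀ᵐ x, x ∈ Icc 0 L → 0 < f x → n x = b) (hm : ∀ᵐ x, x ∈ Icc 0 L → f x < 0 → n x = a) :
    {x | IsTransitionPoint L a b n x}.Finite := by
  refine hfin.subset fun x hx => ⟨hx.1, ?_⟩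
  by_contra hne
  have key (s : Set ℝ) (hs : IsOpen s) (hxs : x ∈ s) (c : ℝ)
      (h : ∀ᵐ y, y ∈ Icc 0 L → y ∈ s → n y ≠ c) :
      ∃ ε > 0, volume {y | y ∈ Icc 0 L ∧ |y - x| < ε ∧ n y = c} = 0 := by
    obtain ⟨ε, hε, hεs⟩ := Metric.isOpen_iff.1 hs x hxs
    refine ⟨ε, hε, measure_mono_null ?_ h⟩
    rintro y ⟨hy1, hy2, hy3⟩ hy
    exact hy hy1 (hεs (by rwa [Metric.mem_ball, Real.dist_eq])) hy3
  rcases lt_or_gt_of_ne hne with h | h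
  · obtain ⟨ε, hε, h0⟩ := key {y | f y < 0} (isOpen_lt hf continuous_const) h b (by
      filter_upwards [hm] with y hy h1 h2
      rw [hy h1 h2]
      exact hab.ne)
    exact (hx.2 ε hε).1.ne' h0
  · obtain ⟨ε, hε, h0⟩ := key {y | 0 < f y} (isOpen_lt continuous_const hf) h a (by
      filter_upwards [hp] with y hy h1 h2
      rw [hy h1 h2]
      exact hab.ne')
    exact (hx.2 ε hε).2.ne' h0

/-- The nodes are `0`, `L` and the zeros of `f`; between consecutive nodes `f` keeps its sign by the
intermediate value theorem. -/
theorem isStepFunction_of_finite {L a b : ℝ} {f n : ℝ → ℝ} (hL : 0 < L) (hf : Continuous f)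
    (hfin : {x ∈ Icc 0 L | f x = 0}.Finite)
    (hp : ∀ᵐ x, x ∈ Icc 0 L → 0 < f x → n x = b) (hm : ∀ᵐ x, x ∈ Icc 0 L → f x < 0 → n x = a) :
    IsStepFunction L a b n := by
  classical
  set S : Finset ℝ := insert 0 (insert L hfin.toFinset) with hS
  have hSI : ∀ x ∈ S, x ∈ Icc 0 L := by
    intro x hx
    simp only [hS, Finset.mem_insert, Set.Finite.mem_toFinset] at hx
    rcases hx with rfl | rfl | hx
    · exact ⟨le_rfl, hL.le⟩
    · exact ⟨hL.le, le_rfl⟩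
    · exact hx.1
  have h0S : (0 : ℝ) ∈ S := by simp [hS]
  have hLS : L ∈ S := by simp [hS]
  have hcard : S.card = (S.card - 1) + 1 :=
    (Nat.sub_add_cancel (Finset.card_pos.2 ⟨0, h0S⟩)).symm
  set e := S.orderEmbOfFin hcard with he
  have heS (i) : e i ∈ S := Finset.orderEmbOfFin_mem S hcard i
  have hsurj : ∀ x ∈ S, ∃ i, e i = x := by
    intro x hx
    have : x ∈ Set.range e := by rw [he, Finset.range_orderEmbOfFin]; exact hx
    exact this
  refine ⟨S.card - 1, e, e.strictMono, ?_, ?_, fun j => ?_⟩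
  · obtain ⟨i, hi⟩ := hsurj 0 h0S
    refine le_antisymm ?_ (hSI _ (heS _)).1
    rw [← hi]
    exact e.monotone (Fin.zero_le i)
  · obtain ⟨i, hi⟩ := hsurj L hLS
    refine le_antisymm (hSI _ (heS _)).2 ?_
    rw [← hi]
    exact e.monotone (Fin.le_last i)
  · have hsub : ∀ y ∈ Ioo (e j.castSucc) (e j.succ), y ∈ Icc 0 L := fun y hy =>
      ⟨(hSI _ (heS _)).1.trans hy.1.le, hy.2.le.trans (hSI _ (heS _)).2⟩
    have hne : ∀ y ∈ Ioo (e j.castSucc) (e j.succ), f y ≠ 0 := by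
      intro y hy h0
      have hyS : y ∈ S := by
        simp only [hS, Finset.mem_insert, Set.Finite.mem_toFinset]
        exact Or.inr (Or.inr ⟨hsub y hy, h0⟩)
      obtain ⟨i, rfl⟩ := hsurj y hyS
      have h1 := e.lt_iff_lt.1 hy.1
      have h2 := e.lt_iff_lt.1 hy.2
      rw [Fin.lt_def] at h1 h2
      simp at h1 h2
      omega
    by_cases hpos : ∀ y ∈ Ioo (e j.castSucc) (e j.succ), 0 < f y
    · left
      filter_upwards [hp] with y hy hyI using hy (hsub y hyI) (hpos y hyI)
    · right
      push Not at hpos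
      obtain ⟨z, hz, hz0⟩ := hpos
      filter_upwards [hm] with y hy hyI
      refine hy (hsub y hyI) (lt_of_le_of_ne ?_ (hne y hyI))
      by_contra! hy0
      obtain ⟨x, hx, hx0⟩ := isPreconnected_Ioo.intermediate_value hz hyI hf.continuousOn
        ⟨hz0, hy0.le⟩
      exact hne x hx hx0

/-! ### Optimality -/

theorem width_lt_of_mem_res {L ρ : ℝ} {m : ℝ → ℝ} {z ω : ℂ} (hz : z ∈ Res L m) (hre : |z.re| ≤ ρ)
    (him : |z.im| < |ω.im|) : width L ρ m < ENNReal.ofReal |ω.im| := by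
  have h : width L ρ m ≤ ENNReal.ofReal |z.im| := iInf₂_le z ⟨hz, hre⟩
  exact h.trans_lt ((ENNReal.ofReal_lt_ofReal_iff ((abs_nonneg _).trans_lt him)).2 him)

/-- Zeros of the characteristic function close to `ω` but with larger imaginary part lower the
width. -/
theorem width_lt_of_charFun_eq_zero {L ρ : ℝ} {m : ℝ → ℝ} {z ω : ℂ} (hL : 0 < L)
    (hm : MemLp (sqIndex m) ⊤ volume) (hz : charFun hL.le hm z = 0) (him : ω.im < z.im)
    (h1 : ‖z - ω‖ < -ω.im) (h2 : ‖z - ω‖ < ρ - |ω.re|) :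
    width L ρ m < ENNReal.ofReal |ω.im| := by
  have hi : z.im < 0 := by
    have := (Complex.abs_im_le_norm (z - ω)).trans_lt h1
    rw [Complex.sub_im] at this
    linarith [le_abs_self (z.im - ω.im)]
  have hr : |z.re| ≤ ρ := by
    have := (Complex.abs_re_le_norm (z - ω)).trans_lt h2
    rw [Complex.sub_re] at this
    linarith [abs_sub_abs_le_abs_sub z.re ω.re]
  have hz0 : z ≠ 0 := by
    rintro rfl
    simp at hi
  obtain ⟨u, w, huw⟩ := exists_isMode_of_charFun_eq_zero hL.le hm hz
  refine width_lt_of_mem_res (huw.mem_res hL hm hz0) hr ?_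
  rw [abs_of_neg hi, abs_of_neg (him.trans hi)]
  linarith

/-- The first-order optimality condition: for some `C ≠ 0`, no direction `β` has
`∫ β Im (C u²) > 0`. -/
theorem exists_multiplier {L a b ρ : ℝ} {n : ℝ → ℝ} {ω : ℂ} {u w : ℝ → ℂ} (hL : 0 < L)
    (ha : 0 < a) (hab : a < b) (hopt : IsLocallyOptimal L a b ρ n)
    (hm : IsMode L ω (sqIndex n) u w) (hω : ENNReal.ofReal |ω.im| = width L ρ n)
    (hρ : |ω.re| < ρ) (hre : ω.re ≠ 0) :
    ∃ C : ℂ, C ≠ 0 ∧ ∀ β, IsDirection L a b n β →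
      ∫ x in (0 : ℝ)..L, β x * (C * u x ^ 2).im ≤ 0 := by
  obtain ⟨hn, δ, hδ, hmin⟩ := hopt
  have hq := memLp_sqIndex hn.1
  have him : ω.im < 0 := hm.im_neg hL hq ha (hn.1.2.2.mono fun x h hx => (h hx).1) hre
  have hω0 : ω ≠ 0 := by rintro rfl; simp at hre
  have huL : u L ≠ 0 := by
    intro h
    have := hm.sq_right_eq_one hL.le hq hn.2
    simp [h] at this
  have hzero : charFun hL.le hq ω = 0 := hm.charFun_eq_zero hL.le hq
  have hana : AnalyticAt ℂ (charFun hL.le hq) ω := (differentiable_charFun hL.le hq).analyticAt ω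
  -- If it vanished near `ω`, the point `ω + iτ` would be a resonance of `n` itself with smaller
  -- width.
  have hne : ¬∀ᶠ z in 𝓝 ω, charFun hL.le hq z = 0 := by
    intro h
    obtain ⟨ε, hε, hεb⟩ := Metric.eventually_nhds_iff_ball.1 h
    set τ : ℝ := min ε (min (-ω.im) (ρ - |ω.re|)) / 2 with hτ
    have hpos : 0 < min ε (min (-ω.im) (ρ - |ω.re|)) :=
      lt_min hε (lt_min (by linarith) (by linarith))
    have hτ0 : 0 < τ := by positivity
    have hτlt : τ < min ε (min (-ω.im) (ρ - |ω.re|)) := half_lt_self hpos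
    have hnorm : ‖ω + τ * Complex.I - ω‖ = τ := by
      rw [add_sub_cancel_left, norm_mul, Complex.norm_I, mul_one, Complex.norm_real,
        Real.norm_of_nonneg hτ0.le]
    have hlt := width_lt_of_charFun_eq_zero (ρ := ρ) (ω := ω) (z := ω + τ * Complex.I) hL hq
      (hεb _ (by
        rw [Metric.mem_ball, dist_eq_norm, hnorm]
        exact hτlt.trans_le (min_le_left _ _)))
      (by simpa using hτ0)
      (by
        rw [hnorm]
        exact hτlt.trans_le ((min_le_right _ _).trans (min_le_left _ _)))
      (by
        rw [hnorm]
        exact hτlt.trans_le ((min_le_right _ _).trans (min_le_right _ _)))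
    exact hlt.ne' hω
  obtain ⟨k, g, hg, hg0, hfg⟩ := hana.exists_eventuallyEq_pow_smul_nonzero_iff.2 hne
  have hk : k ≠ 0 := by
    rintro rfl
    have := hfg.self_of_nhds
    rw [hzero, pow_zero, one_smul] at this
    exact hg0 this.symm
  -- Chosen so that `-A/B = ∫ β C u²`, with `B = g ω` independent of `β`.
  refine ⟨ω ^ 2 / (g ω * u L), div_ne_zero (pow_ne_zero 2 hω0) (mul_ne_zero hg0 huL),
    fun β hβ => ?_⟩
  by_contra! hpos
  set C := ω ^ 2 / (g ω * u L) with hC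
  have hb := hβ.memLp ha hn.1
  have hA := hasDerivAt_charFun hL.le hq hb hm huL
  set A := -ω ^ 2 / u L * ∫ y in (0 : ℝ)..L, (β y : ℂ) * u y ^ 2 with hAdef
  have hAB : -A / g ω = ∫ y in (0 : ℝ)..L, (β y : ℂ) * (C * u y ^ 2) := by
    have : ∀ y, (β y : ℂ) * (C * u y ^ 2) = C * ((β y : ℂ) * u y ^ 2) := fun y => by ring
    simp only [this, intervalIntegral.integral_const_mul]
    rw [hAdef, hC]
    field_simp
  have hint : IntervalIntegrable (fun y => (β y : ℂ) * (C * u y ^ 2)) volume 0 L := by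
    refine (intervalIntegrable_of_memLp_top hb 0 L).mul_continuousOn ?_
    rw [uIcc_of_le hL.le]
    exact continuousOn_const.mul (hm.sol.fst.continuousOn.pow 2)
  have himAB : 0 < (-A / g ω).im := by
    have h1 := intervalIntegral.intervalIntegral_im hint
    have h2 : (∫ y in (0 : ℝ)..L, (β y : ℂ) * (C * u y ^ 2)).im =
        ∫ x in (0 : ℝ)..L, β x * (C * u x ^ 2).im := by
      refine h1.symm.trans (intervalIntegral.integral_congr fun y _ => ?_)
      exact Complex.im_ofReal_mul _ _
    rw [hAB, h2]
    exact hpos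
  have hba : 0 < b ^ 2 - a ^ 2 := by nlinarith
  -- The first two bounds keep the perturbation admissible and in the `L^∞` ball; the last two keep
  -- the new zero below the real axis and in the strip `|Re| ≤ ρ`.
  set ε : ℝ := min (min 1 (δ * a / (b ^ 2 - a ^ 2))) (min (-ω.im) (ρ - |ω.re|)) with hε
  have hε0 : 0 < ε :=
    lt_min (lt_min one_pos (by positivity)) (lt_min (by linarith) (by linarith))
  obtain ⟨t, ht0, htε, z, hzε, hzim, hz⟩ := exists_zero_im_lt (contDiff_charFun hL.le hq hb) hk
    hg.continuousAt rfl hg0 (by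
      filter_upwards [hfg] with z hz
      rw [← smul_eq_mul, ← hz]
      exact charFun_add_zero hL.le hq hb z) hA himAB hε0
  have ht1 : t ≤ 1 := htε.le.trans ((min_le_left _ _).trans (min_le_left _ _))
  have htδ : t * (b ^ 2 - a ^ 2) / a < δ := by
    have := htε.trans_le ((min_le_left _ _).trans (min_le_right _ _))
    rw [lt_div_iff₀ hba] at this
    rwa [div_lt_iff₀ ha]
  have hmem := hβ.perturb_mem ha hn ht0.le ht1
  have hle := hmin _ hmem ((hβ.eLpNorm_perturb_sub_le ha hab hn.1 ht0.le ht1).trans_lt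
    ((ENNReal.ofReal_lt_ofReal_iff hδ).2 htδ))
  have hz' : charFun hL.le (memLp_sqIndex hmem.1) z = 0 := by
    rw [← hz]
    exact charFun_congr hL.le _ _ (hβ.sqIndex_perturb ht0.le ht1) z
  have hlt := width_lt_of_charFun_eq_zero (ρ := ρ) (ω := ω) hL _ hz' hzim
    (hzε.trans_le ((min_le_right _ _).trans (min_le_left _ _)))
    (hzε.trans_le ((min_le_right _ _).trans (min_le_right _ _)))
  rw [hω] at hlt
  exact absurd hle (not_le.2 hlt)

/-- An optimal index is bang-bang: it is extremal wherever the switching function `f` does not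
vanish. -/
theorem bangBang {L a b : ℝ} {n f : ℝ → ℝ} (hL : 0 < L) (ha : 0 < a)
    (hn : n ∈ AdmissibleSym L a b) (hf : Continuous f) (hfs : ∀ x ∈ Icc 0 L, f (L - x) = f x)
    (h : ∀ β, IsDirection L a b n β → ∫ x in (0 : ℝ)..L, β x * f x ≤ 0) :
    (∀ᵐ x, x ∈ Icc 0 L → 0 < f x → n x = b) ∧ ∀ᵐ x, x ∈ Icc 0 L → f x < 0 → n x = a := by
  have hd := isDirection_bangDir ha hn hf hfs
  have hint : IntervalIntegrable (fun x => bangDir L a b f n x * f x) volume 0 L := by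
    have h1 := intervalIntegrable_of_memLp_top (hd.memLp ha hn.1) 0 L
    have h2 : IntervalIntegrable (fun x => bangDir L a b f n x) volume 0 L :=
      ⟨h1.1.re, h1.2.re⟩
    exact h2.mul_continuousOn hf.continuousOn
  have hnn : 0 ≤ᵐ[volume.restrict (Ioc 0 L)] fun x => bangDir L a b f n x * f x := by
    refine (ae_restrict_iff' measurableSet_Ioc).2 ?_
    filter_upwards [hn.1.2.2] with x hx hxI
    obtain ⟨h1, h2⟩ := hx ⟨hxI.1.le, hxI.2⟩
    exact bangDir_mul_nonneg ha h1 h2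
  -- The integrand is nonnegative but optimality makes its integral nonpositive, so the integrand
  -- vanishes a.e.
  have hz : ∫ x in (0 : ℝ)..L, bangDir L a b f n x * f x = 0 :=
    le_antisymm (h _ hd) (intervalIntegral.integral_nonneg_of_ae_restrict hL.le (by
      rwa [← restrict_Ioc_eq_restrict_Icc]))
  have hae := (intervalIntegral.integral_eq_zero_iff_of_le_of_nonneg_ae hL.le hnn hint).1 hz
  have hae' : ∀ᵐ x, x ∈ Icc 0 L → bangDir L a b f n x * f x = 0 := by
    have := (ae_restrict_iff' measurableSet_Ioc).1 hae
    filter_upwards [this, Measure.ae_ne volume (0 : ℝ)] with x hx hx0 hxI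
    exact hx ⟨lt_of_le_of_ne hxI.1 (Ne.symm hx0), hxI.2⟩
  constructor
  · filter_upwards [hae', hn.1.2.2] with x hx hnx hxI hpos
    obtain ⟨h1, h2⟩ := hnx hxI
    have h3 := (mul_eq_zero.1 (hx hxI)).resolve_right hpos.ne'
    rw [bangDir, if_pos hxI, if_pos hpos] at h3
    exact (pow_left_inj₀ (by linarith) (by linarith) two_ne_zero).1 (sub_eq_zero.1 h3).symm
  · filter_upwards [hae', hn.1.2.2] with x hx hnx hxI hneg
    obtain ⟨h1, h2⟩ := hnx hxI
    have h3 := (mul_eq_zero.1 (hx hxI)).resolve_right hneg.ne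
    rw [bangDir, if_pos hxI, if_neg hneg.not_gt, if_pos hneg] at h3
    exact (pow_left_inj₀ (by linarith) ha.le two_ne_zero).1 (sub_eq_zero.1 h3).symm

end ScatRes

end

theorem theorem6p5 (L nminus nplus ρ : ℝ) (hL : 0 < L)
    (hminus : 0 < nminus) (hplus : nminus < nplus)
    (n : ℝ → ℝ) (hn : ScatRes.IsLocallyOptimal L nminus nplus ρ n)
    (ω : ℂ) (hω : ω ∈ ScatRes.Res L n)
    (hopt : ENNReal.ofReal |ω.im| = ScatRes.width L ρ n)
    (hρ : |ω.re| < ρ) (hre : ω.re ≠ 0) :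
    {x : ℝ | ScatRes.IsTransitionPoint L nminus nplus n x}.Finite ∧
      ScatRes.IsStepFunction L nminus nplus n := by
  have hadm := hn.1
  have hq := ScatRes.memLp_sqIndex hadm.1
  have hω0 : ω ≠ 0 := by rintro rfl; simp at hre
  obtain ⟨u, w, hm⟩ := ScatRes.exists_isMode_of_mem_res hL.le hq hω0 hω
  obtain ⟨C, hC0, hC⟩ := ScatRes.exists_multiplier hL hminus hplus hn hm hopt hρ hre
  -- The mode is controlled only on `[0, L]`; the constant extension makes the switching function
  -- continuous on the line.
  set f : ℝ → ℝ := fun x => (C * (Set.IccExtend hL.le ((Set.Icc 0 L).domRestrict u) x) ^ 2).im with hf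
  have hfu : ∀ x ∈ Set.Icc 0 L, f x = (C * u x ^ 2).im := fun x hx => by
    simp only [hf]
    rw [Set.IccExtend_of_mem hL.le _ hx]
    rfl
  have hfc : Continuous f := by
    have : Continuous (Set.IccExtend hL.le ((Set.Icc 0 L).domRestrict u)) :=
      hm.sol.fst.continuousOn.domRestrict.Icc_extend'
    exact Complex.continuous_im.comp (continuous_const.mul (this.pow 2))
  have hfs : ∀ x ∈ Set.Icc 0 L, f (L - x) = f x := fun x hx => by
    rw [hfu x hx, hfu (L - x) ⟨by linarith [hx.2], by linarith [hx.1]⟩,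
      hm.sq_reflect hL.le hq hadm.2 hx]
  have hfin : {x ∈ Set.Icc 0 L | f x = 0}.Finite := by
    refine (hm.finite_im_sq_eq_zero hL hq hminus (hadm.1.2.2.mono fun x h hx => (h hx).1)
      hadm.2 hre hC0).subset fun x hx => ⟨hx.1, ?_⟩
    rw [← hfu x hx.1]
    exact hx.2
  obtain ⟨hp, hm'⟩ := ScatRes.bangBang hL hminus hadm hfc hfs fun β hβ => by
    refine le_of_eq_of_le (intervalIntegral.integral_congr fun x hx => ?_) (hC β hβ)
    rw [Set.uIcc_of_le hL.le] at hx
    simp only [hfu x hx]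
  exact ⟨ScatRes.finite_transition hplus hfc hfin hp hm',
    ScatRes.isStepFunction_of_finite hL hfc hfin hp hm'⟩
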